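/- Let $K$ be a field that is complete with respect to a discrete (nontrivial) non-archimedean valuation $v:K\to\mathbb{R}\cup\{\infty\}$, with valuation ring $A_v$, maximal ideal $\mathfrak{M}=\pi A_v$ and residue field $k=A_v/\mathfrak{M}$. Fix a generator $\pi$ of $\mathfrak M$ and, for every $d\in k^*$, a representative $\Delta(d)\in A_v\setminus\mathfrak{M}$ of $d$. Every $x\in K^*$ is then uniquely $x=\pi^{n}\,\Delta(d)\,e$ with $n\in\mathbb{Z}$ (so $v(x)=n\,v(\pi)$), first digit $d\in k^*$ and tail $e\in 1+\mathfrak{M}$. Let $\mathcal{A}=\{\alpha_1<\alpha_2<\cdots<\alpha_t\}\subset\mathbb{Z}$ be finite with $t\ge 2$, and assume that $\operatorname{char}(k)=0$ or that $\operatorname{char}(k)$ is coprime to $\alpha-\beta$ for all $\alpha\ne\beta$ in $\mathcal{A}$. Let $D_1$ be a probability distribution on $k^*$ and $D_2$ a probability distribution on $1+\mathfrak{M}$. For $\gamma\in\mathbb{N}$ let $E_k(\gamma,D_1)$ be the expected number of roots in $k^*$ of $aX^\gamma+b$, where $a,b\in k^*$ are independent with law $D_1$ (for each positive difference $\gamma$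 of elements of $\mathcal A$, the number of roots is assumed to be a measurable function of $(a,b)$, up to null sets). For $M>0$ let $E(\mathcal{A},D_1,D_2,M,K)$ be the expected number of distinct roots in $K^*$ of $f=\sum_{\alpha\in\mathcal{A}}a_\alpha X^\alpha$, where the coefficients $a_\alpha\in K^*$ are independent and each is chosen by taking, independently, its valuation uniformly in $[-M,M]\cap v(\pi)\mathbb{Z}$, its first digit according to $D_1$ and its tail according to $D_2$. For $\{\alpha_1,\alpha_t\}\subseteq\mathcal{B}\subseteq\mathcal{A}$ let $S(\mathcal{B}/\mathcal{A})\subseteq\mathbb{R}^t$ be the set of all $(v_1,\dots,v_t)$ such that, for every $i$, one has $\alpha_i\in\mathcal{B}$ if and only if $$v_i\le v_j\,\frac{\alpha_i-\alpha_k}{\alpha_j-\alpha_k}+v_k\,\frac{\alpha_j-\alpha_i}{\alpha_j-\alpha_k}\qquad\text{for all } j<i<k,$$ i.e. the points $(\alpha_i,v_i)$ on the lower hull of $\{(\alpha_1,v_1),\dots,(\alpha_t,v_t)\}$ are exactly those with $\alpha_i\in\mathcal{B}$; and let $P(\mathcal{B}/\mathcal{A})$ be the Lebesgue measure of $S(\mathcal{B}/\mathcal{A})\cap[0,1]^t$.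 Then $$\lim_{M\to\infty}E(\mathcal{A},D_1,D_2,M,K)=\sum_{\{\alpha_1,\alpha_t\}\subseteq\mathcal{B}\subseteq\mathcal{A}}P(\mathcal{B}/\mathcal{A})\sum_{i=1}^{|\mathcal{B}|-1}\frac{E_k(\beta_{i+1}-\beta_i,D_1)}{\beta_{i+1}-\beta_i},$$ where $\mathcal{B}=\{\alpha_1=\beta_1<\beta_2<\cdots<\beta_{|\mathcal{B}|}=\alpha_t\}$. In particular the limit exists and does not depend on $D_2$. -/

import Mathlib

open MeasureTheory Filter Topology
open scoped ENNReal

namespace SparseRoots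

noncomputable section

/-- The valuation ring `{x | 0 ≤ v x}` of a real valuation `v : K → ℝ ∪ {∞}`. -/
abbrev valRing {K : Type*} [Field K] (v : AddValuation K (WithTop ℝ)) : ValuationSubring K :=
  v.toValuation.valuationSubring

theorem mem_valRing {K : Type*} [Field K] (v : AddValuation K (WithTop ℝ)) (x : K) :
    x ∈ valRing v ↔ 0 ≤ v x := Iff.rfl

/-- The residue field `k` of `v`. -/
abbrev ResField {K : Type*} [Field K] (v : AddValuation K (WithTop ℝ)) : Type _ :=
  IsLocalRing.ResidueField (valRing v)

/-- `K` is complete with respect to `v`: every Cauchy sequence converges. -/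
def IsValComplete {K : Type*} [Field K] (v : AddValuation K (WithTop ℝ)) : Prop :=
  ∀ u : ℕ → K,
    (∀ C : ℝ, ∃ N : ℕ, ∀ m ≥ N, ∀ n ≥ N, (C : WithTop ℝ) ≤ v (u m - u n)) →
    ∃ x : K, ∀ C : ℝ, ∃ N : ℕ, ∀ n ≥ N, (C : WithTop ℝ) ≤ v (u n - x)

/-- `π` is a nonzero element of the maximal ideal `{x | 0 < v x}` of least valuation, i.e. a
generator of the maximal ideal.  A real valuation has a uniformizer exactly when it is discrete
and nontrivial, its value group then being `v(π)ℤ`. -/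
def IsUniformizer {K : Type*} [Field K] (v : AddValuation K (WithTop ℝ)) (π : K) : Prop :=
  π ≠ 0 ∧ 0 < v π ∧ ∀ x : K, 0 < v x → v π ≤ v x

/-- The group `1 + 𝔐`, as a type. -/
abbrev OneAddMax {K : Type*} [Field K] (v : AddValuation K (WithTop ℝ)) : Type _ :=
  {x : K // 0 < v (x - 1)}

/-- `Δ` chooses a representative, a unit of the valuation ring, of every first digit. -/
def IsDigitSection {K : Type*} [Field K] (v : AddValuation K (WithTop ℝ))
    (Δ : (ResField v)ˣ → (valRing v)ˣ) : Prop :=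
  ∀ d : (ResField v)ˣ, IsLocalRing.residue (valRing v) (Δ d : valRing v) = (d : ResField v)

/-- The element `π ^ n * Δ(d) * e` of `K` with valuation `n * v(π)`, first digit `d`, tail `e`. -/
def assemble {K : Type*} [Field K] (v : AddValuation K (WithTop ℝ)) (π : K)
    (Δ : (ResField v)ˣ → (valRing v)ˣ) (c : ℤ × (ResField v)ˣ × OneAddMax v) : K :=
  π ^ c.1 * ((Δ c.2.1 : valRing v) : K) * (c.2.2 : K)

/-- The set of roots in `K*` of the Laurent polynomial `∑ a ∈ A, c a * X ^ a`. -/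
def unitRoots {K : Type*} [Field K] (A : Finset ℤ) (c : A → K) : Set Kˣ :=
  {x : Kˣ | ∑ a : A, c a * ((x ^ (a : ℤ) : Kˣ) : K) = 0}

/-- The law of one random coefficient (in terms of exponent of `π`, first digit, and tail):
the valuation is uniform in `[-M, M] ∩ v(π)ℤ`, the first digit has law `D₁` and the tail has
law `D₂`, all three independent. -/
def coeffLaw {K : Type*} [Field K] (v : AddValuation K (WithTop ℝ)) (π : K)
    [MeasurableSpace (ResField v)ˣ] [MeasurableSpace (OneAddMax v)]
    (D₁ : Measure (ResField v)ˣ) (D₂ : Measure (OneAddMax v)) (M : ℝ) :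
    Measure (ℤ × (ResField v)ˣ × OneAddMax v) :=
  (ProbabilityTheory.uniformOn
    {n : ℤ | ((-M : ℝ) : WithTop ℝ) ≤ v (π ^ n) ∧ v (π ^ n) ≤ (M : WithTop ℝ)}).prod
    (D₁.prod D₂)

/-- The expected number of distinct roots in `K*` of a polynomial with support `A` and
independent random coefficients. -/
def expectedRoots {K : Type*} [Field K] (v : AddValuation K (WithTop ℝ)) (π : K)
    (Δ : (ResField v)ˣ → (valRing v)ˣ)
    [MeasurableSpace (ResField v)ˣ] [MeasurableSpace (OneAddMax v)]
    (D₁ : Measure (ResField v)ˣ) (D₂ : Measure (OneAddMax v)) (A : Finset ℤ) (M : ℝ) : ℝ≥0∞ :=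
  ∫⁻ ω : A → ℤ × (ResField v)ˣ × OneAddMax v,
    (((unitRoots A fun a => assemble v π Δ (ω a)).encard : ℕ∞) : ℝ≥0∞)
    ∂(Measure.pi fun _ : A => coeffLaw v π D₁ D₂ M)

/-- The number of roots in `F*` of the binomial `a X ^ γ + b`, where `p = (a, b)`. -/
def binomialRootCount (F : Type*) [Field F] (γ : ℕ) (p : Fˣ × Fˣ) : ℝ≥0∞ :=
  (({x : Fˣ | (p.1 : F) * (x : F) ^ γ + (p.2 : F) = 0}.encard : ℕ∞) : ℝ≥0∞)

/-- `E_F(γ, D)`: the expected number of roots in `F*` of `a X ^ γ + b`, with `a` and `b`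
independent of law `D`. -/
def expectedBinomialRoots (F : Type*) [Field F] [MeasurableSpace Fˣ] (γ : ℕ)
    (D : Measure Fˣ) : ℝ≥0∞ :=
  ∫⁻ p : Fˣ × Fˣ, binomialRootCount F γ p ∂(D.prod D)

/-- The set `S(B/A)` of vectors `w` such that the points `(a, w a)` lying on the lower hull of
`{(a, w a) | a ∈ A}` are exactly those with `a ∈ B`. -/
def newtonSupportSet (A B : Finset ℤ) : Set (A → ℝ) :=
  {w | ∀ a : A,
    (∀ a' a'' : A, a' < a → a < a'' →
      w a ≤ w a' * ((((a : ℤ) : ℝ) - ((a'' : ℤ) : ℝ)) / (((a' : ℤ) : ℝ) - ((a'' : ℤ) : ℝ)))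
        + w a'' * ((((a' : ℤ) : ℝ) - ((a : ℤ) : ℝ)) / (((a' : ℤ) : ℝ) - ((a'' : ℤ) : ℝ))))
    ↔ (a : ℤ) ∈ B}

/-- `P(B/A)`: the Lebesgue measure of `S(B/A) ∩ [0,1]^A`. -/
def newtonSupportProb (A B : Finset ℤ) : ℝ≥0∞ :=
  volume (newtonSupportSet A B ∩ Set.Icc 0 1)

/-- The pairs `(βᵢ, βᵢ₊₁)` of consecutive elements of `B = {β₁ < β₂ < ⋯}`. -/
def consecutivePairs (B : Finset ℤ) : Finset (ℤ × ℤ) :=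
  (B ×ˢ B).filter fun p => p.1 < p.2 ∧ ∀ b ∈ B, ¬ (p.1 < b ∧ b < p.2)

end

end SparseRoots

open SparseRoots

/-! Write the coefficients as `π ^ n a * W a` with `W a` a unit, and a prospective root as `x = π ^
m * u` with `u` a unit. After division by the least power of `π`, only the terms minimising `n a + m
* a` survive in the residue field. If one term survives, the reduction is a monomial and `x` is not
a root. If no three of the points `(a, n a)` are collinear, at most two terms survive; when there
are two, at `a < b`, these are consecutive vertices of the lower hull, and the reduction is a
monomial times `d b * X ^ (b - a) + d a`. As `b - a` is invertible in the residue field, the nonzero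
roots of this binomial are simple, and Hensel's lemma lifts each to exactly one unit `u`. An edge
`(a, b)` arises from an integer `m` exactly when `b - a` divides `n b - n a`. So the number of roots
is the sum, over the edges passing this divisibility test, of binomial root counts in the residue
field (`encard_unitRoots_of_generalPosition`).

In this formula the hull and the divisibility depend only on the exponents, the binomials only on
the first digits, and nothing on the tails. By independence each edge contributes a probability
times `E_k(γ, D₁)` with `γ = b - a`. The probability that a uniform integer point of a large cube
has hull support `B` and satisfies the divisibility tends to `P(B/A) / γ`: the sublattice is the
image of `ℤ^t` under a linear map of determinant `γ`, and counting lattice points in a bounded set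
with null frontier gives volumes (`tendsto_pi_uniformInt`). Collinear triples have limiting
probability `0`, and the number of roots is bounded by `max A - min A`, so they do not affect the
limit. -/

namespace SparseRoots

/-! ### Discrete valuations and Hensel's lemma -/

section Valuation

variable {K : Type*} [Field K] {v : AddValuation K (WithTop ℝ)} {π : K}

theorem isUnit_valRing_iff (x : valRing v) : IsUnit x ↔ v (x : K) = 0 := by
  constructor
  · rintro ⟨u, rfl⟩
    have h1 : 0 ≤ v ((u : valRing v) : K) := (mem_valRing v _).1 (u : valRing v).2
    have h2 : 0 ≤ v (((u⁻¹ : (valRing v)ˣ) : valRing v) : K) :=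
      (mem_valRing v _).1 ((u⁻¹ : (valRing v)ˣ) : valRing v).2
    have h3 : v ((u : valRing v) : K) + v (((u⁻¹ : (valRing v)ˣ) : valRing v) : K) = 0 := by
      rw [← v.map_mul, ← v.map_one]
      congr 1
      exact_mod_cast congrArg (Subtype.val) (u.mul_inv)
    refine le_antisymm ?_ h1
    rw [← h3]
    exact le_add_of_nonneg_right h2
  · intro h
    have hx : (x : K) ≠ 0 := by
      intro h0
      rw [h0, v.map_zero] at h
      exact absurd h (by simp)
    have hinv : (x : K)⁻¹ ∈ valRing v := by
      rw [mem_valRing, AddValuation.map_inv, h, neg_zero]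
    refine IsUnit.of_mul_eq_one ⟨(x : K)⁻¹, hinv⟩ ?_
    ext
    exact mul_inv_cancel₀ hx

theorem residue_eq_zero_iff_pos (x : valRing v) :
    IsLocalRing.residue (valRing v) x = 0 ↔ 0 < v (x : K) := by
  rw [← not_iff_not, ← ne_eq, IsLocalRing.residue_ne_zero_iff_isUnit, isUnit_valRing_iff]
  have h1 : 0 ≤ v (x : K) := (mem_valRing v _).1 x.2
  rw [not_lt]
  exact ⟨fun h => h.le, fun h => le_antisymm h h1⟩

theorem residue_eq_iff_pos (x y : valRing v) :
    IsLocalRing.residue (valRing v) x = IsLocalRing.residue (valRing v) y ↔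
      0 < v ((x : K) - y) := by
  rw [← sub_eq_zero, ← map_sub, residue_eq_zero_iff_pos]
  rfl

theorem dvd_of_valuation_le {x y : valRing v} (h : v (x : K) ≤ v (y : K)) : x ∣ y := by
  by_cases hx : (x : K) = 0
  · rw [hx, v.map_zero, top_le_iff, AddValuation.top_iff] at h
    have : y = 0 := Subtype.ext h
    simp [this]
  · have hxv : v (x : K) ≠ ⊤ := by rwa [ne_eq, AddValuation.top_iff]
    have hq : (x : K)⁻¹ * y ∈ valRing v := by
      rw [mem_valRing, v.map_mul, AddValuation.map_inv]
      obtain ⟨r, hr⟩ := WithTop.ne_top_iff_exists.1 hxv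
      rw [← hr] at h ⊢
      cases hy : v (y : K) with
      | top => simp
      | coe s =>
        rw [hy] at h
        have : r ≤ s := by exact_mod_cast h
        have e : -(r : WithTop ℝ) + (s : WithTop ℝ) = ((-r + s : ℝ) : WithTop ℝ) := rfl
        rw [e]
        exact_mod_cast (by linarith : (0:ℝ) ≤ -r + s)
    refine ⟨⟨_, hq⟩, Subtype.ext ?_⟩
    change (y : K) = x * ((x : K)⁻¹ * y)
    field_simp

theorem valuation_le_of_dvd {x y : valRing v} (h : x ∣ y) : v (x : K) ≤ v (y : K) := by
  obtain ⟨z, rfl⟩ := h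
  have h1 : 0 ≤ v (z : K) := (mem_valRing v _).1 z.2
  change _ ≤ v ((x : K) * z)
  rw [v.map_mul]
  exact le_add_of_nonneg_right h1

theorem IsUniformizer.exists_real (hπ : IsUniformizer v π) :
    ∃ r : ℝ, 0 < r ∧ ∀ n : ℤ, v (π ^ n) = ((n * r : ℝ) : WithTop ℝ) := by
  have hne : v π ≠ ⊤ := by rw [ne_eq, AddValuation.top_iff]; exact hπ.1
  obtain ⟨r, hr⟩ := WithTop.ne_top_iff_exists.1 hne
  have hpos := hπ.2.1
  rw [← hr] at hpos
  have hnat : ∀ n : ℕ, v (π ^ n) = ((n * r : ℝ) : WithTop ℝ) := by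
    intro n
    rw [v.map_pow, ← hr]
    induction n with
    | zero => simp
    | succ n ih =>
      rw [succ_nsmul, ih, Nat.cast_succ, add_mul, one_mul]
      rfl
  refine ⟨r, by exact_mod_cast hpos, fun n => ?_⟩
  obtain ⟨k, rfl | rfl⟩ := n.eq_nat_or_neg
  · rw [zpow_natCast, hnat]
    simp
  · rw [zpow_neg, AddValuation.map_inv, zpow_natCast, hnat]
    rw [Int.cast_neg, neg_mul]
    rfl

/-- Dividing by `π ^ ⌊v x / v π⌋` leaves a valuation in `[0, v π)`, and `v π` is the least positive
one. -/
theorem IsUniformizer.exists_eq_zpow_mul (hπ : IsUniformizer v π) {x : K} (hx : x ≠ 0) :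
    ∃ m : ℤ, ∃ u : (valRing v)ˣ, x = π ^ m * ((u : valRing v) : K) := by
  obtain ⟨r, hr, hrn⟩ := hπ.exists_real
  have hne : v x ≠ ⊤ := by rwa [ne_eq, AddValuation.top_iff]
  obtain ⟨s, hs⟩ := WithTop.ne_top_iff_exists.1 hne
  have hval : v (π ^ (-⌊s / r⌋) * x) = ((s - ⌊s / r⌋ * r : ℝ) : WithTop ℝ) := by
    rw [v.map_mul, hrn, ← hs, ← WithTop.coe_add]
    congr 1
    push_cast
    ring
  have h0 : 0 ≤ s - ⌊s / r⌋ * r := by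
    have := mul_le_mul_of_nonneg_right (Int.floor_le (s / r)) hr.le
    rw [div_mul_cancel₀ _ hr.ne'] at this
    linarith
  have h1 : s - ⌊s / r⌋ * r < r := by
    have := mul_lt_mul_of_pos_right (Int.lt_floor_add_one (s / r)) hr
    rw [div_mul_cancel₀ _ hr.ne'] at this
    linarith
  have hz : v (π ^ (-⌊s / r⌋) * x) = 0 := by
    by_contra hcon
    have hpos : 0 < v (π ^ (-⌊s / r⌋) * x) := by
      refine lt_of_le_of_ne ?_ (Ne.symm hcon)
      rw [hval]
      exact_mod_cast h0
    have := hπ.2.2 _ hpos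
    have e := hrn 1
    rw [zpow_one] at e
    rw [hval, e] at this
    have : (1 : ℤ) * r ≤ s - ⌊s / r⌋ * r := by exact_mod_cast this
    push_cast at this
    linarith
  have hmem : π ^ (-⌊s / r⌋) * x ∈ valRing v := by
    rw [mem_valRing, hz]
  obtain ⟨u, hu⟩ := (isUnit_valRing_iff (⟨_, hmem⟩ : valRing v)).2 hz
  refine ⟨⌊s / r⌋, u, ?_⟩
  rw [hu]
  change x = π ^ ⌊s / r⌋ * (π ^ (-⌊s / r⌋) * x)
  rw [← mul_assoc, ← zpow_add₀ hπ.1, add_neg_cancel, zpow_zero, one_mul]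

theorem IsUniformizer.zpow_mul_injective (hπ : IsUniformizer v π) {m m' : ℤ}
    {u u' : (valRing v)ˣ}
    (h : π ^ m * ((u : valRing v) : K) = π ^ m' * ((u' : valRing v) : K)) : m = m' ∧ u = u' := by
  obtain ⟨r, hr, hrn⟩ := hπ.exists_real
  have hm : m = m' := by
    have h' := congrArg v h
    rw [v.map_mul, v.map_mul, hrn, hrn, (isUnit_valRing_iff _).1 u.isUnit,
      (isUnit_valRing_iff _).1 u'.isUnit, add_zero, add_zero] at h'
    have : (m : ℝ) * r = m' * r := by exact_mod_cast h'
    exact_mod_cast mul_right_cancel₀ hr.ne' this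
  subst hm
  refine ⟨rfl, Units.ext (Subtype.ext ?_)⟩
  exact mul_left_cancel₀ (zpow_ne_zero _ hπ.1) h

/-- Hensel's lemma for a not necessarily monic polynomial. -/
theorem exists_root_of_residue (hcomplete : IsValComplete v) (hπ : IsUniformizer v π)
    (f : Polynomial (valRing v)) (s : ResField v)
    (hs : (f.map (IsLocalRing.residue (valRing v))).eval s = 0)
    (hs' : (f.map (IsLocalRing.residue (valRing v))).derivative.eval s ≠ 0) :
    ∃ x : valRing v, f.eval x = 0 ∧ IsLocalRing.residue (valRing v) x = s := by
  obtain ⟨r, hr, hrn⟩ := hπ.exists_real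
  obtain ⟨a, rfl⟩ := IsLocalRing.residue_surjective s
  rw [Polynomial.eval_map, Polynomial.eval₂_hom] at hs
  rw [Polynomial.derivative_map, Polynomial.eval_map, Polynomial.eval₂_hom,
    IsLocalRing.residue_ne_zero_iff_isUnit] at hs'
  obtain ⟨c, hc⟩ := hs'.exists_left_inv
  set ϖ : valRing v := ⟨π, (mem_valRing v _).2 hπ.2.1.le⟩ with hϖ
  have hϖpow : ∀ n : ℕ, v ((ϖ ^ n : valRing v) : K) = ((n * r : ℝ) : WithTop ℝ) := by
    intro n
    have := hrn n
    rw [zpow_natCast] at this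
    rw [SubmonoidClass.coe_pow, this]
    simp
  have hdvd : ∀ y : valRing v, IsLocalRing.residue (valRing v) y = 0 ↔ ϖ ∣ y := by
    intro y
    rw [residue_eq_zero_iff_pos]
    exact ⟨fun h => dvd_of_valuation_le (hπ.2.2 _ h),
      fun h => lt_of_lt_of_le hπ.2.1 (valuation_le_of_dvd h)⟩
  -- Newton iteration with the fixed inverse `c` of the derivative at `a`; linear convergence is
  -- enough.
  obtain ⟨u, hu0, husucc⟩ : ∃ u : ℕ → valRing v, u 0 = a ∧
      ∀ n, u (n + 1) = u n - c * f.eval (u n) :=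
    ⟨fun n => Nat.rec a (fun _ y => y - c * f.eval y) n, rfl, fun _ => rfl⟩
  have key : ∀ n, ϖ ∣ u n - a ∧ ϖ ^ (n + 1) ∣ f.eval (u n) := by
    intro n
    induction n with
    | zero =>
      refine ⟨by simp [hu0], ?_⟩
      rw [zero_add, pow_one, hu0]
      exact (hdvd _).1 hs
    | succ n ih =>
      obtain ⟨h1, h2⟩ := ih
      have h3 : ϖ ∣ f.eval (u n) := (dvd_pow_self ϖ n.succ_ne_zero).trans h2
      refine ⟨?_, ?_⟩
      · rw [husucc, sub_right_comm]
        exact dvd_sub h1 (h3.mul_left c)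
      -- Taylor expansion shows that a step multiplies `f (u n)` by `(1 - c * f' (u n)) + k * c ^ 2
      -- * f (u n)`. Since `u n ≡ a` modulo `ϖ` and `c * f' a = 1`, this factor is divisible by `ϖ`.
      · obtain ⟨k, hk⟩ := f.binomExpansion (u n) (-(c * f.eval (u n)))
        have h4 : ϖ ∣ 1 - c * f.derivative.eval (u n) := by
          rw [← hc, ← mul_sub, ← dvd_neg, ← mul_neg, neg_sub]
          exact (h1.trans (Polynomial.sub_dvd_eval_sub _ _ _)).mul_left c
        rw [husucc, sub_eq_add_neg, hk]
        have e : f.eval (u n) + f.derivative.eval (u n) * -(c * f.eval (u n)) +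
            k * (-(c * f.eval (u n))) ^ 2 =
            f.eval (u n) * ((1 - c * f.derivative.eval (u n)) + k * c ^ 2 * f.eval (u n)) := by
          ring
        rw [e, pow_succ]
        exact mul_dvd_mul h2 (dvd_add h4 (h3.mul_left _))
  have hstep : ∀ n m, n ≤ m → ϖ ^ (n + 1) ∣ u m - u n := by
    intro n m hnm
    induction m, hnm using Nat.le_induction with
    | base => simp
    | succ m hm ih =>
      rw [husucc, sub_right_comm]
      exact dvd_sub ih (((pow_dvd_pow ϖ (by omega)).trans (key m).2).mul_left c)
  have harch : ∀ C : ℝ, ∃ N : ℕ, C ≤ N * r := by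
    intro C
    obtain ⟨N, hN⟩ := exists_nat_ge (C / r)
    exact ⟨N, by rwa [div_le_iff₀ hr] at hN⟩
  have hstep' : ∀ n m : ℕ, n ≤ m → (((n : ℝ) * r : ℝ) : WithTop ℝ) ≤ v ((u m - u n : valRing v) : K) := by
    intro n m hnm
    rw [← hϖpow]
    exact valuation_le_of_dvd ((pow_dvd_pow ϖ n.le_succ).trans (hstep n m hnm))
  obtain ⟨x, hx⟩ := hcomplete (fun n => (u n : K)) (by
    intro C
    obtain ⟨N, hN⟩ := harch C
    refine ⟨N, fun m hm n hn => ?_⟩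
    have e : (u m : K) - u n = ((u m : K) - u N) - ((u n : K) - u N) := by ring
    rw [e]
    refine le_trans (le_trans (WithTop.coe_le_coe.2 hN) ?_) (v.map_sub _ _)
    exact le_min (hstep' N m hm) (hstep' N n hn))
  have hxmem : x ∈ valRing v := by
    obtain ⟨N, hN⟩ := hx 0
    have e : x = (u N : K) - ((u N : K) - x) := by ring
    rw [mem_valRing, e]
    exact le_trans (le_min ((mem_valRing v _).1 (u N).2) (hN N le_rfl)) (v.map_sub _ _)
  refine ⟨⟨x, hxmem⟩, ?_, ?_⟩
  -- The value at the limit has valuation at least every real `C`, hence vanishes.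
  · refine Subtype.ext ((AddValuation.top_iff v).1 ?_)
    refine WithTop.eq_top_iff_forall_ge.2 fun C => ?_
    obtain ⟨N₁, hN₁⟩ := hx C
    obtain ⟨N₂, hN₂⟩ := harch C
    set N := max N₁ N₂
    have h1 : (C : WithTop ℝ) ≤ v ((f.eval (u N) : valRing v) : K) := by
      refine le_trans ?_ (valuation_le_of_dvd (key N).2)
      rw [hϖpow]
      refine WithTop.coe_le_coe.2 (hN₂.trans ?_)
      have : (N₂ : ℝ) ≤ (N + 1 : ℕ) := by
        exact_mod_cast (le_max_right N₁ N₂).trans (Nat.le_succ _)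
      exact mul_le_mul_of_nonneg_right this hr.le
    have h2 : (C : WithTop ℝ) ≤
        v ((f.eval (u N) - f.eval (⟨x, hxmem⟩ : valRing v) : valRing v) : K) :=
      (hN₁ N (le_max_left _ _)).trans
        (valuation_le_of_dvd (x := u N - ⟨x, hxmem⟩) (Polynomial.sub_dvd_eval_sub _ _ _))
    have e : ((f.eval (⟨x, hxmem⟩ : valRing v) : valRing v) : K) =
        ((f.eval (u N) : valRing v) : K) -
          ((f.eval (u N) - f.eval (⟨x, hxmem⟩ : valRing v) : valRing v) : K) := by
      push_cast
      ring
    rw [e]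
    exact (le_min h1 h2).trans (v.map_sub _ _)
  · obtain ⟨N, hN⟩ := hx 1
    have h1 : IsLocalRing.residue (valRing v) (u N) = IsLocalRing.residue (valRing v) a := by
      rw [← sub_eq_zero, ← map_sub]
      exact (hdvd _).2 (key N).1
    rw [← h1, eq_comm, residue_eq_iff_pos]
    exact lt_of_lt_of_le (by exact_mod_cast one_pos) (hN N le_rfl)

/-- Expanding at `x` gives `0 = (y - x) * (f' x + k * (y - x))`, whose second factor has the nonzero
residue of `f' x`. -/
theorem root_eq_of_residue_eq (f : Polynomial (valRing v)) {x y : valRing v}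
    (hx : f.eval x = 0) (hy : f.eval y = 0)
    (hxy : IsLocalRing.residue (valRing v) x = IsLocalRing.residue (valRing v) y)
    (hx' : (f.map (IsLocalRing.residue (valRing v))).derivative.eval
      (IsLocalRing.residue (valRing v) x) ≠ 0) : x = y := by
  rw [Polynomial.derivative_map, Polynomial.eval_map, Polynomial.eval₂_hom] at hx'
  obtain ⟨k, hk⟩ := f.binomExpansion x (y - x)
  rw [add_sub_cancel, hx, hy] at hk
  have hprod : (y - x) * (f.derivative.eval x + k * (y - x)) = 0 := by
    linear_combination -hk
  have hne : f.derivative.eval x + k * (y - x) ≠ 0 := by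
    intro h0
    have := congrArg (IsLocalRing.residue (valRing v)) h0
    rw [map_add, map_mul, map_sub, hxy, sub_self, mul_zero, add_zero, map_zero] at this
    exact hx' this
  exact (sub_eq_zero.1 ((mul_eq_zero.1 hprod).resolve_right hne)).symm

/-- If all nonzero roots of the reduction of `f` are simple, reduction is a bijection between the
unit roots of `f` and the nonzero roots of its reduction. -/
theorem encard_unit_roots_eq (hcomplete : IsValComplete v) (hπ : IsUniformizer v π)
    (f : Polynomial (valRing v))
    (hsimple : ∀ s : (ResField v)ˣ,
      (f.map (IsLocalRing.residue (valRing v))).eval (s : ResField v) = 0 →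
      (f.map (IsLocalRing.residue (valRing v))).derivative.eval (s : ResField v) ≠ 0) :
    {u : (valRing v)ˣ | f.eval (u : valRing v) = 0}.encard =
      {s : (ResField v)ˣ |
        (f.map (IsLocalRing.residue (valRing v))).eval (s : ResField v) = 0}.encard := by
  have hred : ∀ x : valRing v, (f.map (IsLocalRing.residue (valRing v))).eval
      (IsLocalRing.residue (valRing v) x) = IsLocalRing.residue (valRing v) (f.eval x) := by
    intro x
    rw [Polynomial.eval_map, Polynomial.eval₂_hom]
  set φ : (valRing v)ˣ → (ResField v)ˣ :=
    fun u => Units.map (IsLocalRing.residue (valRing v)).toMonoidHom u with hφ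
  have hφv : ∀ u, ((φ u : (ResField v)ˣ) : ResField v) =
    IsLocalRing.residue (valRing v) (u : valRing v) := fun u => rfl
  have hinj : Set.InjOn φ {u : (valRing v)ˣ | f.eval (u : valRing v) = 0} := by
    intro x hx y hy hxy
    refine Units.ext (root_eq_of_residue_eq f hx hy ?_ ?_)
    · rw [← hφv, ← hφv, hxy]
    · rw [← hφv]
      refine hsimple _ ?_
      rw [hφv, hred, hx.out, map_zero]
  rw [← hinj.encard_image]
  congr 1
  ext s
  simp only [Set.mem_image, Set.mem_ofPred_eq]
  constructor
  · rintro ⟨u, hu, rfl⟩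
    rw [hφv, hred, hu, map_zero]
  · intro hs
    obtain ⟨x, hx, hxs⟩ := exists_root_of_residue hcomplete hπ f s hs (hsimple s hs)
    have hxu : IsUnit x := by
      rw [← IsLocalRing.residue_ne_zero_iff_isUnit, hxs]
      exact s.ne_zero
    obtain ⟨u, rfl⟩ := hxu
    exact ⟨u, hx, Units.ext hxs⟩

end Valuation

/-! ### Lower hulls and supporting lines -/

section NewtonPolygon

/-- The point `(a, w a)` lies below, on or above the line through `(a', w a')` and `(a'', w a'')`
according to the sign of this number, when `a' < a < a''`. -/
noncomputable def turn {A : Finset ℤ} (a' a a'' : A) (w : A → ℝ) : ℝ :=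
  w a' * (((a'' : ℤ) : ℝ) - ((a : ℤ) : ℝ)) + w a'' * (((a : ℤ) : ℝ) - ((a' : ℤ) : ℝ))
    - w a * (((a'' : ℤ) : ℝ) - ((a' : ℤ) : ℝ))

/-- The vectors `w` such that no three of the points `(a, w a)` are collinear. -/
def generalPosition (A : Finset ℤ) : Set (A → ℝ) :=
  {w | ∀ a' a a'' : A, a' < a → a < a'' → turn a' a a'' w ≠ 0}

variable {A : Finset ℤ}

theorem cast_lt_cast {a b : A} (h : a < b) : ((a : ℤ) : ℝ) < ((b : ℤ) : ℝ) := by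
  exact_mod_cast h

theorem le_interpolation_iff {a' a a'' : A} (h1 : a' < a) (h2 : a < a'') (w : A → ℝ) :
    (w a ≤ w a' * ((((a : ℤ) : ℝ) - ((a'' : ℤ) : ℝ)) / (((a' : ℤ) : ℝ) - ((a'' : ℤ) : ℝ)))
        + w a'' * ((((a' : ℤ) : ℝ) - ((a : ℤ) : ℝ)) / (((a' : ℤ) : ℝ) - ((a'' : ℤ) : ℝ)))) ↔
      0 ≤ turn a' a a'' w := by
  have h : (0 : ℝ) < ((a'' : ℤ) : ℝ) - ((a' : ℤ) : ℝ) := sub_pos.2 (cast_lt_cast (h1.trans h2))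
  have hne : ((a' : ℤ) : ℝ) - ((a'' : ℤ) : ℝ) ≠ 0 := by linarith
  have e : w a' * ((((a : ℤ) : ℝ) - ((a'' : ℤ) : ℝ)) / (((a' : ℤ) : ℝ) - ((a'' : ℤ) : ℝ)))
      + w a'' * ((((a' : ℤ) : ℝ) - ((a : ℤ) : ℝ)) / (((a' : ℤ) : ℝ) - ((a'' : ℤ) : ℝ))) - w a =
      turn a' a a'' w / (((a'' : ℤ) : ℝ) - ((a' : ℤ) : ℝ)) := by
    rw [turn]
    field_simp
    ring
  rw [← sub_nonneg, e, le_div_iff₀ h, zero_mul]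

theorem mem_newtonSupportSet_iff {B : Finset ℤ} {w : A → ℝ} :
    w ∈ newtonSupportSet A B ↔
      ∀ a : A, (∀ a' a'' : A, a' < a → a < a'' → 0 ≤ turn a' a a'' w) ↔ (a : ℤ) ∈ B := by
  refine forall_congr' fun a => iff_congr ?_ Iff.rfl
  exact forall₄_congr fun a' a'' h1 h2 => le_interpolation_iff h1 h2 w

theorem mem_consecutivePairs_iff {B : Finset ℤ} {p : ℤ × ℤ} :
    p ∈ consecutivePairs B ↔ p.1 ∈ B ∧ p.2 ∈ B ∧ p.1 < p.2 ∧ ∀ b ∈ B, ¬ (p.1 < b ∧ b < p.2) := by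
  simp [consecutivePairs, and_assoc]

/-- In general position, the line through two consecutive vertices lies strictly below the other
points. -/
theorem line_lt_of_mem_consecutivePairs {B : Finset ℤ} {w : A → ℝ}
    (hw : w ∈ newtonSupportSet A B) (hgen : w ∈ generalPosition A) {a b : A}
    (hab : ((a : ℤ), (b : ℤ)) ∈ consecutivePairs B) {c : A} (hca : c ≠ a) (hcb : c ≠ b) :
    w a * (((b : ℤ) : ℝ) - ((c : ℤ) : ℝ)) + w b * (((c : ℤ) : ℝ) - ((a : ℤ) : ℝ)) <
      w c * (((b : ℤ) : ℝ) - ((a : ℤ) : ℝ)) := by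
  obtain ⟨haB, hbB, hlt, hcons⟩ := mem_consecutivePairs_iff.1 hab
  have hltA : a < b := hlt
  rw [mem_newtonSupportSet_iff] at hw
  have hab' := cast_lt_cast hltA
  -- `h c` is the height of the point at `c` above the line through `a` and `b`, scaled by `b - a`.
  -- General position makes it nonzero away from `a` and `b`.
  let h : A → ℝ := fun c => w c * (((b : ℤ) : ℝ) - ((a : ℤ) : ℝ)) -
    (w a * (((b : ℤ) : ℝ) - ((c : ℤ) : ℝ)) + w b * (((c : ℤ) : ℝ) - ((a : ℤ) : ℝ)))
  suffices hs : 0 ≤ h c by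
    have hne : h c ≠ 0 := by
      rcases lt_or_gt_of_ne hca with h1 | h1
      · intro h0
        refine hgen c a b h1 hltA ?_
        rw [← h0]
        simp only [turn, h]
        ring
      · rcases lt_or_gt_of_ne hcb with h2 | h2
        · intro h0
          refine hgen a c b h1 h2 ?_
          rw [← neg_eq_zero, ← h0]
          simp only [turn, h]
          ring
        · intro h0
          refine hgen a b c hltA h2 ?_
          rw [← h0]
          simp only [turn, h]
          ring
    exact sub_pos.1 (lt_of_le_of_ne hs hne.symm)
  -- Suppose the lowest point `d` relative to the line lies strictly below it. Left of `a` or right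
  -- of `b`, it would put `a` or `b` above a chord; strictly between them, minimality makes `d` a
  -- hull point, so `a` and `b` are not consecutive.
  obtain ⟨d, -, hd⟩ := Finset.exists_min_image Finset.univ h ⟨a, Finset.mem_univ a⟩
  refine le_trans ?_ (hd c (Finset.mem_univ c))
  by_contra hneg
  rw [not_le] at hneg
  rcases lt_trichotomy d a with h1 | h1 | h1
  · have := (hw a).2 haB d b h1 hltA
    simp only [turn] at this
    simp only [h] at hneg
    linarith
  · subst h1
    simp only [h] at hneg
    linarith
  rcases lt_trichotomy d b with h2 | h2 | h2
  · refine hcons d ((hw d).1 fun a' a'' h3 h4 => ?_) ⟨h1, h2⟩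
    have h5 := hd a' (Finset.mem_univ _)
    have h6 := hd a'' (Finset.mem_univ _)
    have h3' := sub_pos.2 (cast_lt_cast h3)
    have h4' := sub_pos.2 (cast_lt_cast h4)
    have h7 := mul_le_mul_of_nonneg_right h5 h4'.le
    have h8 := mul_le_mul_of_nonneg_right h6 h3'.le
    refine nonneg_of_mul_nonneg_left (b := ((b : ℤ) : ℝ) - ((a : ℤ) : ℝ)) ?_ (sub_pos.2 hab')
    simp only [h] at h7 h8
    simp only [turn]
    linarith
  · subst h2
    simp only [h] at hneg
    linarith
  · have := (hw b).2 hbB a d hltA h2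
    simp only [turn] at this
    simp only [h] at hneg
    linarith

/-- Points on a supporting line satisfy every chord inequality, so `a` and `b` are on the hull. Any
point between them is strictly above the line, hence above the chord from `a` to `b`, and is
excluded from `B`. -/
theorem mem_consecutivePairs_of_line {B : Finset ℤ} {w : A → ℝ} (hBA : B ⊆ A)
    (hw : w ∈ newtonSupportSet A B) {a b : A} (hlt : a < b) (m μ : ℝ)
    (hle : ∀ c : A, μ ≤ w c + m * ((c : ℤ) : ℝ))
    (heq : ∀ c : A, w c + m * ((c : ℤ) : ℝ) = μ ↔ c = a ∨ c = b) :
    ((a : ℤ), (b : ℤ)) ∈ consecutivePairs B := by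
  rw [mem_newtonSupportSet_iff] at hw
  have hvert : ∀ c : A, w c + m * ((c : ℤ) : ℝ) = μ → (c : ℤ) ∈ B := by
    intro c hc
    refine (hw c).1 fun a' a'' h1 h2 => ?_
    have h3 := mul_le_mul_of_nonneg_right (hle a') (sub_pos.2 (cast_lt_cast h2)).le
    have h4 := mul_le_mul_of_nonneg_right (hle a'') (sub_pos.2 (cast_lt_cast h1)).le
    rw [turn, eq_sub_of_add_eq hc]
    linarith
  refine mem_consecutivePairs_iff.2
    ⟨hvert a ((heq a).2 (.inl rfl)), hvert b ((heq b).2 (.inr rfl)), hlt, fun c hc hcab => ?_⟩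
  have h1 : a < (⟨c, hBA hc⟩ : A) := hcab.1
  have h2 : (⟨c, hBA hc⟩ : A) < b := hcab.2
  have h3 := (hw ⟨c, hBA hc⟩).2 hc a b h1 h2
  have h4 : μ < w ⟨c, hBA hc⟩ + m * (c : ℝ) := by
    refine lt_of_le_of_ne (hle ⟨c, hBA hc⟩) fun h => ?_
    rcases (heq ⟨c, hBA hc⟩).1 h.symm with h5 | h5
    · exact h1.ne h5.symm
    · exact h2.ne h5
  have h5 := mul_lt_mul_of_pos_right h4 (sub_pos.2 (cast_lt_cast hlt))
  rw [turn, eq_sub_of_add_eq ((heq a).2 (.inl rfl)), eq_sub_of_add_eq ((heq b).2 (.inr rfl))] at h3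
  dsimp only at h3
  linarith

/-- In general position, a line below the points meets at most two of them. -/
theorem not_three_on_line {w : A → ℝ} (hgen : w ∈ generalPosition A) {a b c : A}
    (hab : a < b) (hbc : b < c) (m μ : ℝ) (ha : w a + m * ((a : ℤ) : ℝ) = μ)
    (hb : w b + m * ((b : ℤ) : ℝ) = μ) (hc : w c + m * ((c : ℤ) : ℝ) = μ) : False := by
  refine hgen a b c hab hbc ?_
  rw [turn, eq_sub_of_add_eq ha, eq_sub_of_add_eq hb, eq_sub_of_add_eq hc]
  ring

end NewtonPolygon

/-! ### Counting roots for fixed coefficients -/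

section RootCount

variable {K : Type*} [Field K] {v : AddValuation K (WithTop ℝ)} {π : K}

/-- The polynomial over the valuation ring obtained from `∑ a, π ^ n a * W a * X ^ a` by the
substitution `X ↦ π ^ m * X` and division by `π ^ μ * X ^ l`. -/
noncomputable def rescaledPoly (v : AddValuation K (WithTop ℝ)) (ϖ : valRing v) {A : Finset ℤ}
    (n : A → ℤ) (W : A → (valRing v)ˣ) (l m μ : ℤ) : Polynomial (valRing v) :=
  ∑ a : A, Polynomial.C (ϖ ^ (n a + m * a - μ).toNat * (W a : valRing v)) *
    Polynomial.X ^ ((a : ℤ) - l).toNat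

variable {A : Finset ℤ} {n : A → ℤ} {W : A → (valRing v)ˣ} {l m μ : ℤ}

theorem sum_eq_rescaledPoly (hπ : IsUniformizer v π) (hl : ∀ a : A, l ≤ a)
    (hμ : ∀ a : A, μ ≤ n a + m * a) (u : (valRing v)ˣ) :
    ∑ a : A, π ^ n a * ((W a : valRing v) : K) * (π ^ m * ((u : valRing v) : K)) ^ (a : ℤ) =
      π ^ μ * ((u : valRing v) : K) ^ l *
        (((rescaledPoly v ⟨π, (mem_valRing v _).2 hπ.2.1.le⟩ n W l m μ).eval (u : valRing v) :
          valRing v) : K) := by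
  have hu : ((u : valRing v) : K) ≠ 0 := fun h => u.ne_zero (Subtype.ext h)
  rw [rescaledPoly, Polynomial.eval_finsetSum, AddSubmonoidClass.coe_finsetSum, Finset.mul_sum]
  refine Finset.sum_congr rfl fun a _ => ?_
  simp only [Polynomial.eval_mul, Polynomial.eval_C, Polynomial.eval_pow, Polynomial.eval_X]
  push_cast
  -- Both exponents are nonnegative by `hμ` and `hl`, so `toNat` truncates nothing.
  have h1 : π ^ (n a + m * a - μ).toNat = π ^ (n a + m * a - μ) := by
    rw [← zpow_natCast, Int.toNat_of_nonneg (by linarith [hμ a])]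
  have h2 : ((u : valRing v) : K) ^ ((a : ℤ) - l).toNat = ((u : valRing v) : K) ^ ((a : ℤ) - l) := by
    rw [← zpow_natCast, Int.toNat_of_nonneg (by linarith [hl a])]
  rw [h1, h2, mul_zpow, ← zpow_mul, zpow_sub₀ hπ.1, zpow_sub₀ hu, zpow_add₀ hπ.1]
  have h3 := zpow_ne_zero μ hπ.1
  have h4 := zpow_ne_zero l hu
  field_simp

theorem sum_eq_zero_iff_rescaledPoly (hπ : IsUniformizer v π) (hl : ∀ a : A, l ≤ a)
    (hμ : ∀ a : A, μ ≤ n a + m * a) (u : (valRing v)ˣ) :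
    ∑ a : A, π ^ n a * ((W a : valRing v) : K) * (π ^ m * ((u : valRing v) : K)) ^ (a : ℤ) = 0 ↔
      (rescaledPoly v ⟨π, (mem_valRing v _).2 hπ.2.1.le⟩ n W l m μ).eval (u : valRing v) = 0 := by
  have hu : ((u : valRing v) : K) ≠ 0 := fun h => u.ne_zero (Subtype.ext h)
  rw [sum_eq_rescaledPoly hπ hl hμ, mul_eq_zero, mul_eq_zero]
  simp [zpow_ne_zero _ hπ.1, zpow_ne_zero _ hu]

theorem map_residue_rescaledPoly (hπ : IsUniformizer v π) (hμ : ∀ a : A, μ ≤ n a + m * a) :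
    (rescaledPoly v ⟨π, (mem_valRing v _).2 hπ.2.1.le⟩ n W l m μ).map
        (IsLocalRing.residue (valRing v)) =
      ∑ a : A with n a + m * a = μ,
        Polynomial.C (IsLocalRing.residue (valRing v) (W a : valRing v)) *
          Polynomial.X ^ ((a : ℤ) - l).toNat := by
  have h0 : IsLocalRing.residue (valRing v) ⟨π, (mem_valRing v _).2 hπ.2.1.le⟩ = 0 :=
    (residue_eq_zero_iff_pos _).2 hπ.2.1
  rw [rescaledPoly, Polynomial.map_sum, Finset.sum_filter]
  refine Finset.sum_congr rfl fun a _ => ?_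
  rw [Polynomial.map_mul, Polynomial.map_C, Polynomial.map_pow, Polynomial.map_X, map_mul, map_pow,
    h0]
  split_ifs with h
  · rw [h, sub_self, Int.toNat_zero, pow_zero, one_mul]
  · have : (n a + m * a - μ).toNat ≠ 0 := by have := hμ a; omega
    rw [zero_pow this, zero_mul, map_zero, zero_mul]

/-- The reduction is `X ^ e * (d b * X ^ γ + d a)` with `γ = b - a`. At a nonzero root `s` its
derivative is `s ^ e * d b * γ * s ^ (γ - 1)`, nonzero by `hchar`, so residues and unit roots
correspond. -/
theorem encard_unit_roots_rescaled (hcomplete : IsValComplete v) (hπ : IsUniformizer v π)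
    (hμ : ∀ a : A, μ ≤ n a + m * a) {a b : A} (hab : a < b)
    (heq : ∀ c : A, n c + m * c = μ ↔ c = a ∨ c = b)
    (hchar : (((b : ℤ) - a : ℤ) : ResField v) ≠ 0) (d : A → (ResField v)ˣ)
    (hd : ∀ a, IsLocalRing.residue (valRing v) (W a : valRing v) = d a) :
    {u : (valRing v)ˣ | ∑ a : A, π ^ n a * ((W a : valRing v) : K) *
      (π ^ m * ((u : valRing v) : K)) ^ (a : ℤ) = 0}.encard =
    {s : (ResField v)ˣ | (d b : ResField v) * (s : ResField v) ^ ((b : ℤ) - a).toNat +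
      (d a : ResField v) = 0}.encard := by
  set l := A.min' ⟨a, a.2⟩ with hl'
  have hl : ∀ a : A, l ≤ a := fun a => A.min'_le a a.2
  simp only [sum_eq_zero_iff_rescaledPoly hπ hl hμ]
  have hmap := map_residue_rescaledPoly (W := W) (l := l) hπ hμ
  have hfil : (Finset.univ.filter fun c : A => n c + m * c = μ) = {a, b} := by
    ext c
    simp [heq c]
  rw [hfil, Finset.sum_pair hab.ne, hd, hd] at hmap
  have hsplit : ((b : ℤ) - l).toNat = ((a : ℤ) - l).toNat + ((b : ℤ) - a).toNat := by
    have h1 := hl a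
    have h2 : (a : ℤ) < b := hab
    omega
  have heval : ∀ s : (ResField v)ˣ,
      ((rescaledPoly v ⟨π, (mem_valRing v _).2 hπ.2.1.le⟩ n W l m μ).map
        (IsLocalRing.residue (valRing v))).eval (s : ResField v) = 0 ↔
      (d b : ResField v) * (s : ResField v) ^ ((b : ℤ) - a).toNat + (d a : ResField v) = 0 := by
    intro s
    rw [hmap]
    simp only [Polynomial.eval_add, Polynomial.eval_mul, Polynomial.eval_C, Polynomial.eval_pow,
      Polynomial.eval_X]
    have e : (d a : ResField v) * (s : ResField v) ^ ((a : ℤ) - l).toNat +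
        (d b : ResField v) * (s : ResField v) ^ ((b : ℤ) - l).toNat =
        (s : ResField v) ^ ((a : ℤ) - l).toNat *
        ((d b : ResField v) * (s : ResField v) ^ ((b : ℤ) - a).toNat + (d a : ResField v)) := by
      rw [hsplit, pow_add]
      ring
    rw [e, mul_eq_zero]
    simp
  rw [encard_unit_roots_eq hcomplete hπ]
  · simp only [heval]
  · intro s hs
    have hs0 := (heval s).1 hs
    rw [hmap, hsplit, pow_add]
    set e := ((a : ℤ) - l).toNat
    obtain ⟨g, hg⟩ : ∃ g, ((b : ℤ) - a).toNat = g + 1 := by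
      have h2 : (a : ℤ) < b := hab
      exact ⟨((b : ℤ) - a).toNat - 1, by omega⟩
    have hg' : ((g : ResField v) + 1) ≠ 0 := by
      have h2 : (a : ℤ) < b := hab
      have : ((b : ℤ) - a) = ((g + 1 : ℕ) : ℤ) := by omega
      rw [this] at hchar
      exact_mod_cast hchar
    rw [hg] at hs0 ⊢
    have e1 : Polynomial.C (d a : ResField v) * Polynomial.X ^ e +
        Polynomial.C (d b : ResField v) * (Polynomial.X ^ e * Polynomial.X ^ (g + 1)) =
        Polynomial.X ^ e * (Polynomial.C (d b : ResField v) * Polynomial.X ^ (g + 1) +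
          Polynomial.C (d a : ResField v)) := by ring
    rw [e1, Polynomial.derivative_mul, Polynomial.eval_add, Polynomial.eval_mul,
      Polynomial.eval_mul]
    have e2 : Polynomial.eval (s : ResField v) (Polynomial.C (d b : ResField v) *
        Polynomial.X ^ (g + 1) + Polynomial.C (d a : ResField v)) = 0 := by
      simpa using hs0
    rw [e2, mul_zero, zero_add]
    simp [hg']

/-- The reduction is a monomial with nonzero coefficient, which has no nonzero root. -/
theorem rescaled_ne_zero (hπ : IsUniformizer v π)
    (hμ : ∀ a : A, μ ≤ n a + m * a) {a : A} (heq : ∀ c : A, n c + m * c = μ ↔ c = a)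
    (u : (valRing v)ˣ) :
    ∑ a : A, π ^ n a * ((W a : valRing v) : K) *
      (π ^ m * ((u : valRing v) : K)) ^ (a : ℤ) ≠ 0 := by
  set l := A.min' ⟨a, a.2⟩ with hl'
  have hl : ∀ a : A, l ≤ a := fun a => A.min'_le a a.2
  rw [ne_eq, sum_eq_zero_iff_rescaledPoly hπ hl hμ]
  intro h0
  have hmap := map_residue_rescaledPoly (W := W) (l := l) hπ hμ
  have hfil : (Finset.univ.filter fun c : A => n c + m * c = μ) = {a} := by
    ext c
    simp [heq c]
  rw [hfil, Finset.sum_singleton] at hmap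
  have h1 := congrArg (Polynomial.eval (IsLocalRing.residue (valRing v) (u : valRing v))) hmap
  rw [Polynomial.eval_map, Polynomial.eval₂_hom, h0, map_zero] at h1
  have hW : IsLocalRing.residue (valRing v) (W a : valRing v) ≠ 0 :=
    (IsLocalRing.residue_ne_zero_iff_isUnit _).2 (W a).isUnit
  have hu : IsLocalRing.residue (valRing v) (u : valRing v) ≠ 0 :=
    (IsLocalRing.residue_ne_zero_iff_isUnit _).2 u.isUnit
  have h2 : IsLocalRing.residue (valRing v) (W a : valRing v) *
      IsLocalRing.residue (valRing v) (u : valRing v) ^ ((a : ℤ) - l).toNat = 0 := by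
    simpa using h1.symm
  exact mul_ne_zero hW (pow_ne_zero _ hu) h2

/-- The pairs of elements of `A` that are consecutive in `B`. -/
def supportPairs (A B : Finset ℤ) : Finset (A × A) :=
  Finset.univ.filter fun q => ((q.1 : ℤ), (q.2 : ℤ)) ∈ consecutivePairs B

theorem mem_supportPairs {B : Finset ℤ} {q : A × A} :
    q ∈ supportPairs A B ↔ ((q.1 : ℤ), (q.2 : ℤ)) ∈ consecutivePairs B := by
  simp [supportPairs]

theorem encard_unitRoots_of_generalPosition (hcomplete : IsValComplete v)
    (hπ : IsUniformizer v π) (hA : A.Nonempty) {B : Finset ℤ} (hBA : B ⊆ A)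
    (hchar : ∀ a b : A, a < b → (((b : ℤ) - a : ℤ) : ResField v) ≠ 0)
    (hw : (fun a => (n a : ℝ)) ∈ newtonSupportSet A B)
    (hgen : (fun a => (n a : ℝ)) ∈ generalPosition A) (d : A → (ResField v)ˣ)
    (hd : ∀ a, IsLocalRing.residue (valRing v) (W a : valRing v) = d a) :
    (unitRoots A fun a => π ^ n a * ((W a : valRing v) : K)).encard =
      ∑ q ∈ supportPairs A B with ((q.2 : ℤ) - q.1) ∣ n q.2 - n q.1,
        {s : (ResField v)ˣ | (d q.2 : ResField v) * (s : ResField v) ^ ((q.2 : ℤ) - q.1).toNat +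
          (d q.1 : ResField v) = 0}.encard := by
  set Q := (supportPairs A B).filter fun q => ((q.2 : ℤ) - q.1) ∣ n q.2 - n q.1 with hQ
  -- The exponent `m` solving `n q.1 + m * q.1 = n q.2 + m * q.2`, the negative of the edge slope;
  -- the division is exact for pairs in `Q`.
  let slope : A × A → ℤ := fun q => -((n q.2 - n q.1) / ((q.2 : ℤ) - q.1))
  let μ : A × A → ℤ := fun q => n q.1 + slope q * q.1
  have hQlt : ∀ q ∈ Q, q.1 < q.2 := fun q hq =>
    (mem_consecutivePairs_iff.1 (mem_supportPairs.1 (Finset.mem_filter.1 hq).1)).2.2.1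
  have hμ2 : ∀ q ∈ Q, n q.2 + slope q * q.2 = μ q := by
    intro q hq
    have h1 := Int.ediv_mul_cancel (Finset.mem_filter.1 hq).2
    simp only [μ, slope]
    linear_combination -h1
  have hμlt : ∀ q ∈ Q, ∀ c : A, c ≠ q.1 → c ≠ q.2 → μ q < n c + slope q * c := by
    intro q hq c hc1 hc2
    have h1 := line_lt_of_mem_consecutivePairs hw hgen
      (mem_supportPairs.1 (Finset.mem_filter.1 hq).1) hc1 hc2
    have h2 : n q.1 * ((q.2 : ℤ) - c) + n q.2 * ((c : ℤ) - q.1) < n c * ((q.2 : ℤ) - q.1) := by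
      exact_mod_cast h1
    have h3 : (0 : ℤ) < (q.2 : ℤ) - q.1 := sub_pos.2 (hQlt q hq)
    have h4 := hμ2 q hq
    have h5 : n q.1 + slope q * q.1 = μ q := rfl
    refine lt_of_mul_lt_mul_right ?_ h3.le
    rw [eq_sub_of_add_eq h4, eq_sub_of_add_eq h5] at h2
    linarith
  have hμle : ∀ q ∈ Q, ∀ c : A, μ q ≤ n c + slope q * c := by
    intro q hq c
    by_cases h1 : c = q.1
    · rw [h1]
    · by_cases h2 : c = q.2
      · rw [h2, hμ2 q hq]
      · exact (hμlt q hq c h1 h2).le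
  have hμeq : ∀ q ∈ Q, ∀ c : A, n c + slope q * c = μ q ↔ c = q.1 ∨ c = q.2 := by
    intro q hq c
    refine ⟨fun h => ?_, ?_⟩
    · by_contra hcon
      rw [not_or] at hcon
      exact (hμlt q hq c hcon.1 hcon.2).ne' h
    · rintro (h | h)
      · rw [h]
      · rw [h, hμ2 q hq]
  let embed : ℤ → (valRing v)ˣ → Kˣ := fun m u =>
    Units.mk0 π hπ.1 ^ m * Units.map (valRing v).subtype.toMonoidHom u
  have hembed : ∀ m u, ((embed m u : Kˣ) : K) = π ^ m * ((u : valRing v) : K) := by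
    intro m u
    simp [embed]
  let R : A × A → Set Kˣ := fun q => embed (slope q) '' {u : (valRing v)ˣ |
    ∑ a : A, π ^ n a * ((W a : valRing v) : K) *
      (π ^ slope q * ((u : valRing v) : K)) ^ (a : ℤ) = 0}
  have hroots : (unitRoots A fun a => π ^ n a * ((W a : valRing v) : K)) =
      ⋃ q ∈ (Q : Set (A × A)), R q := by
    ext x
    simp only [unitRoots, Set.mem_ofPred_eq, Set.mem_iUnion, exists_prop, R, Set.mem_image,
      Finset.mem_coe]
    constructor
    · intro hx
      -- For a root `π ^ m * u` the minimum of `n c + m * c` is attained twice, and by general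
      -- position not three times; the two places form an edge in `Q`.
      obtain ⟨m, u, hxu⟩ := hπ.exists_eq_zpow_mul x.ne_zero
      simp only [Units.val_zpow_eq_zpow_val, hxu] at hx
      obtain ⟨a₀, ha₀⟩ := hA
      obtain ⟨a, -, ha⟩ := Finset.exists_min_image Finset.univ (fun a : A => n a + m * a)
        ⟨⟨a₀, ha₀⟩, Finset.mem_univ _⟩
      have hmin : ∀ c : A, n a + m * a ≤ n c + m * c := fun c => ha c (Finset.mem_univ c)
      obtain ⟨b, hb, hba⟩ : ∃ b : A, n b + m * b = n a + m * a ∧ b ≠ a := by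
        by_contra hcon
        push Not at hcon
        exact rescaled_ne_zero hπ hmin
          (fun c => ⟨fun h => hcon c h, fun h => by rw [h]⟩) u hx
      have hpair : ∃ a' b' : A, a' < b' ∧ n a' + m * a' = n a + m * a ∧
          n b' + m * b' = n a + m * a := by
        rcases lt_or_gt_of_ne hba with h | h
        · exact ⟨b, a, h, hb, rfl⟩
        · exact ⟨a, b, h, rfl, hb⟩
      obtain ⟨a', b', hlt, ha', hb'⟩ := hpair
      have hreal : ∀ c : A, n c + m * c = n a + m * a ↔
          (n c : ℝ) + (m : ℝ) * ((c : ℤ) : ℝ) = ((n a + m * a : ℤ) : ℝ) := by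
        intro c
        exact_mod_cast Iff.rfl
      have hcons : ((a' : ℤ), (b' : ℤ)) ∈ consecutivePairs B := by
        refine mem_consecutivePairs_of_line hBA hw hlt m ((n a + m * a : ℤ) : ℝ)
          (fun c => by exact_mod_cast hmin c) fun c => ?_
        rw [← hreal]
        refine ⟨fun h => ?_, ?_⟩
        · by_contra hcon
          rw [not_or] at hcon
          rw [hreal] at h ha' hb'
          rcases lt_or_gt_of_ne hcon.1 with h1 | h1
          · exact not_three_on_line hgen h1 hlt m _ h ha' hb'
          · rcases lt_or_gt_of_ne hcon.2 with h2 | h2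
            · exact not_three_on_line hgen h1 h2 m _ ha' h hb'
            · exact not_three_on_line hgen hlt h2 m _ ha' hb' h
        · rintro (rfl | rfl)
          · exact ha'
          · exact hb'
      have hmul : n b' - n a' = ((b' : ℤ) - a') * (-m) := by linear_combination hb' - ha'
      have hslope : slope (a', b') = m := by
        have : (b' : ℤ) - a' ≠ 0 :=
          (sub_pos.2 (show (a' : ℤ) < b' from hlt)).ne'
        simp only [slope]
        rw [hmul, Int.mul_ediv_cancel_left _ this, neg_neg]
      refine ⟨(a', b'), Finset.mem_filter.2 ⟨mem_supportPairs.2 hcons, ⟨-m, hmul⟩⟩, u, ?_, ?_⟩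
      · rw [hslope]
        exact hx
      · rw [hslope]
        exact Units.ext ((hembed m u).trans hxu.symm)
    · rintro ⟨q, -, u, hu, rfl⟩
      simp only [Units.val_zpow_eq_zpow_val, hembed]
      exact hu
  -- A common root would give both edges the same exponent `m`, hence the same minimum and the same
  -- two minimisers.
  have hdisj : (Q : Set (A × A)).PairwiseDisjoint R := by
    intro q hq q' hq' hne
    refine Set.disjoint_left.2 ?_
    rintro x ⟨u, -, rfl⟩ ⟨u', -, hu'⟩
    have h1 := congrArg (fun x : Kˣ => (x : K)) hu'
    simp only [hembed] at h1
    have h2 := (hπ.zpow_mul_injective h1).1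
    have h3 : μ q = μ q' := by
      refine le_antisymm ?_ ?_
      · have := hμle q hq q'.1
        rwa [← h2] at this
      · have := hμle q' hq' q.1
        rwa [h2] at this
    have h4 : ∀ c : A, (c = q.1 ∨ c = q.2) ↔ (c = q'.1 ∨ c = q'.2) := by
      intro c
      rw [← hμeq q hq, ← hμeq q' hq', h2, h3]
    have h5 := hQlt q hq
    have h6 := hQlt q' hq'
    refine hne (Prod.ext ?_ ?_)
    · rcases (h4 q.1).1 (.inl rfl) with h | h
      · exact h
      · rcases (h4 q'.1).2 (.inl rfl) with h' | h'
        · exact h'.symm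
        · have h7 : q.2 < q.1 := by rw [h, ← h']; exact h6
          exact absurd h5 (not_lt.2 h7.le)
    · rcases (h4 q.2).1 (.inr rfl) with h | h
      · rcases (h4 q'.2).2 (.inr rfl) with h' | h'
        · have h7 : q.2 < q.1 := by rw [h, ← h']; exact h6
          exact absurd h5 (not_lt.2 h7.le)
        · exact h'.symm
      · exact h
  rw [hroots, Set.Finite.encard_biUnion Q.finite_toSet hdisj, finsum_mem_coe_finset]
  refine Finset.sum_congr rfl fun q hq => ?_
  have hinj : Function.Injective (embed (slope q)) := by
    intro u u' h
    have h1 := congrArg (fun x : Kˣ => (x : K)) h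
    simp only [hembed] at h1
    exact (hπ.zpow_mul_injective h1).2
  rw [hinj.encard_image]
  exact encard_unit_roots_rescaled hcomplete hπ (hμle q hq) (hQlt q hq) (hμeq q hq)
    (hchar _ _ (hQlt q hq)) d hd

end RootCount

/-! ### Integer points of a cone in a large cube, under a congruence -/

section Equidistribution

open scoped Pointwise

/-- The uniform law on `{-R, …, R}`. -/
noncomputable def uniformInt (R : ℕ) : Measure ℤ :=
  ProbabilityTheory.uniformOn ((Finset.Icc (-R : ℤ) R : Finset ℤ) : Set ℤ)

instance (R : ℕ) : IsProbabilityMeasure (uniformInt R) :=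
  ProbabilityTheory.isProbabilityMeasure_uniformOn (Finset.finite_toSet _)
    ⟨0, by simp⟩

theorem uniformInt_singleton {R : ℕ} {n : ℤ} (hn : n ∈ Finset.Icc (-R : ℤ) R) :
    uniformInt R {n} = ((2 * R + 1 : ℕ) : ℝ≥0∞)⁻¹ := by
  rw [uniformInt, ← Finset.coe_singleton, ProbabilityTheory.uniformOn_apply_finset,
    Finset.inter_singleton_of_mem hn, Finset.card_singleton, Int.card_Icc, Nat.cast_one, one_div]
  congr 2
  omega

variable {ι : Type*} [Fintype ι]

theorem pi_uniformInt_apply (R : ℕ) (T : Set (ι → ℤ)) :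
    (Measure.pi fun _ : ι => uniformInt R) T =
      (Nat.card {n : ι → ℤ // n ∈ T ∧ ∀ i, n i ∈ Finset.Icc (-R : ℤ) R} : ℝ≥0∞) *
        (((2 * R + 1 : ℕ) : ℝ≥0∞)⁻¹) ^ Fintype.card ι := by
  classical
  set box : Set (ι → ℤ) := Set.univ.pi fun _ => ((Finset.Icc (-R : ℤ) R : Finset ℤ) : Set ℤ)
  have hbox : (Measure.pi fun _ : ι => uniformInt R) boxᶜ = 0 := by
    rw [prob_compl_eq_zero_iff (MeasurableSet.of_discrete), Measure.pi_pi]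
    refine Finset.prod_eq_one fun i _ => ?_
    exact ProbabilityTheory.uniformOn_self (Finset.finite_toSet _) ⟨0, by simp⟩
  set F : Finset (ι → ℤ) := (Fintype.piFinset fun _ => Finset.Icc (-R : ℤ) R).filter (· ∈ T)
  have hF : T ∩ box = (F : Set (ι → ℤ)) := by
    ext n
    simp only [F, box, Set.mem_inter_iff, Set.mem_univ_pi, Finset.mem_coe, Finset.mem_filter,
      Fintype.mem_piFinset, and_comm]
  have hcard : Nat.card {n : ι → ℤ // n ∈ T ∧ ∀ i, n i ∈ Finset.Icc (-R : ℤ) R} = F.card := by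
    rw [← Nat.card_eq_finsetCard F]
    refine Nat.card_congr (Equiv.subtypeEquivRight fun n => ?_)
    simp only [F, Finset.mem_filter, Fintype.mem_piFinset, and_comm]
  rw [← measure_inter_conull hbox, hF, ← sum_measure_singleton, hcard,
    Finset.sum_congr rfl (g := fun _ => (((2 * R + 1 : ℕ) : ℝ≥0∞)⁻¹) ^ Fintype.card ι),
    Finset.sum_const, nsmul_eq_mul]
  intro n hn
  rw [Measure.pi_singleton, Finset.prod_congr rfl fun i _ => uniformInt_singleton (n := n i) ?_,
    Finset.prod_const, Finset.card_univ]
  exact Fintype.mem_piFinset.1 (Finset.mem_filter.1 hn).1 i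

/-- The map `x ↦ 2 * x - 1` carries the first cube onto the second and preserves `S`. -/
theorem volume_inter_Icc {S : Set (ι → ℝ)} (hS : ∀ t : ℝ, 0 < t → ∀ w ∈ S, t • w ∈ S)
    (hS' : ∀ c : ℝ, ∀ w ∈ S, (fun i => w i + c) ∈ S) :
    volume (S ∩ Set.Icc 0 1) =
      ENNReal.ofReal ((2 ^ Fintype.card ι)⁻¹) * volume (S ∩ Set.Icc (-1) 1) := by
  have h1 : S ∩ Set.Icc 0 1 = (fun x => (2 : ℝ) • x) ⁻¹' ((fun x => x + (-1)) ⁻¹'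
      (S ∩ Set.Icc (-1) 1)) := by
    ext x
    simp only [Set.mem_inter_iff, Set.mem_preimage]
    refine and_congr ⟨fun h => ?_, fun h => ?_⟩ ?_
    · exact hS' (-1) _ (hS 2 two_pos x h)
    · have := hS 2⁻¹ (by norm_num) _ (hS' 1 _ h)
      convert this using 1
      ext i
      simp
    · simp only [Set.mem_Icc, Pi.le_def, ← forall_and]
      refine forall_congr' fun i => ?_
      simp only [Pi.zero_apply, Pi.one_apply, Pi.neg_apply, Pi.add_apply, Pi.smul_apply,
        smul_eq_mul]
      constructor <;> rintro ⟨h1, h2⟩ <;> constructor <;> linarith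
  rw [h1, Measure.addHaar_preimage_smul _ two_ne_zero, measure_preimage_add_right,
    Module.finrank_fintype_fun_eq_card, abs_of_pos (by positivity)]

variable [DecidableEq ι]

/-- The linear map sending `x` to `x` with its `j`-th coordinate replaced by `x i + γ * x j`. -/
noncomputable def shear (i j : ι) (γ : ℝ) : (ι → ℝ) →ₗ[ℝ] (ι → ℝ) :=
  Matrix.toLin' (Matrix.transvection j i 1 * Matrix.diagonal (Function.update 1 j γ))

theorem shear_apply {i j : ι} (hij : i ≠ j) (γ : ℝ) (x : ι → ℝ) (k : ι) :
    shear i j γ x k = if k = j then x i + γ * x j else x k := by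
  rw [shear, Matrix.toLin'_mul, LinearMap.comp_apply, Matrix.toLin'_apply, Matrix.toLin'_apply,
    Matrix.transvection, Matrix.add_mulVec, Matrix.one_mulVec]
  simp only [Pi.add_apply, Matrix.mulVec_diagonal, Matrix.single_mulVec]
  split_ifs with h
  · subst h
    simp [hij, add_comm]
  · simp [h]

theorem det_shear {i j : ι} (hij : i ≠ j) (γ : ℝ) : LinearMap.det (shear i j γ) = γ := by
  rw [shear, LinearMap.det_toLin', Matrix.det_mul, Matrix.det_transvection_of_ne _ _ hij.symm,
    Matrix.det_diagonal, one_mul, Finset.prod_update_of_mem (Finset.mem_univ j)]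
  simp

/-- The vectors with `γ ∣ n j - n i` are parametrised by replacing `m j` with `m i + γ * m j`, which
is the shear on integer vectors. Scaling by `R⁻¹` turns the box into `[-1, 1]^ι` and preserves the
cone. -/
theorem card_dvd_eq_card_shear {i j : ι} (hij : i ≠ j) {γ : ℕ} (hγ : 0 < γ) {S : Set (ι → ℝ)}
    (hS : ∀ t : ℝ, 0 < t → ∀ w ∈ S, t • w ∈ S) {R : ℕ} (hR : 0 < R) :
    Nat.card {n : ι → ℤ // n ∈ {n : ι → ℤ | (fun k => (n k : ℝ)) ∈ S ∧ (γ : ℤ) ∣ n j - n i} ∧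
        ∀ k, n k ∈ Finset.Icc (-R : ℤ) R} =
      Nat.card ↑((shear i j γ ⁻¹' (S ∩ Set.Icc (-1) 1)) ∩
        (R : ℝ)⁻¹ • (Submodule.span ℤ (Set.range (Pi.basisFun ℝ ι)) : Set (ι → ℝ))) := by
  let f : (ι → ℤ) → (ι → ℤ) := fun m k => if k = j then m i + γ * m j else m k
  let g : (ι → ℤ) → (ι → ℝ) := fun m k => (R : ℝ)⁻¹ * m k
  have hR' : (0 : ℝ) < R := by exact_mod_cast hR
  have hγ' : (γ : ℤ) ≠ 0 := by exact_mod_cast hγ.ne'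
  have hf : Function.Injective f := by
    intro m m' h
    have h1 : ∀ k, k ≠ j → m k = m' k := by
      intro k hk
      simpa [f, hk] using congrFun h k
    ext k
    by_cases hk : k = j
    · subst hk
      have h2 := congrFun h k
      simp only [f, if_true, h1 i hij] at h2
      exact mul_left_cancel₀ hγ' (add_left_cancel h2)
    · exact h1 k hk
  have hg : Function.Injective g := by
    intro m m' h
    ext k
    have h2 := mul_left_cancel₀ (inv_ne_zero hR'.ne') (congrFun h k)
    exact_mod_cast h2
  have hsg : ∀ m, shear i j γ (g m) = (R : ℝ)⁻¹ • fun k => (f m k : ℝ) := by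
    intro m
    ext k
    rw [shear_apply hij, Pi.smul_apply, smul_eq_mul]
    by_cases hk : k = j
    · simp only [hk, if_true, g, f]
      push_cast
      ring
    · simp [hk, g, f]
  let M : Set (ι → ℤ) := {m | (fun k => (f m k : ℝ)) ∈ S ∧ ∀ k, f m k ∈ Finset.Icc (-R : ℤ) R}
  have h1 : {n : ι → ℤ | n ∈ {n : ι → ℤ | (fun k => (n k : ℝ)) ∈ S ∧ (γ : ℤ) ∣ n j - n i} ∧
        ∀ k, n k ∈ Finset.Icc (-R : ℤ) R} = f '' M := by
    ext n
    constructor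
    · rintro ⟨⟨h1, c, hc⟩, h2⟩
      have hfn : f (Function.update n j c) = n := by
        ext k
        by_cases hk : k = j
        · subst hk
          simp only [f, if_true, Function.update_self, Function.update_of_ne hij]
          linarith
        · simp [f, hk]
      refine ⟨Function.update n j c, ?_, hfn⟩
      simp only [M, Set.mem_ofPred_eq, hfn]
      exact ⟨h1, h2⟩
    · rintro ⟨m, ⟨h1, h2⟩, rfl⟩
      exact ⟨⟨h1, m j, by simp [f, hij]⟩, h2⟩
  have h2 : (shear i j γ ⁻¹' (S ∩ Set.Icc (-1) 1)) ∩
        (R : ℝ)⁻¹ • (Submodule.span ℤ (Set.range (Pi.basisFun ℝ ι)) : Set (ι → ℝ)) = g '' M := by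
    have hbox : ∀ m : ι → ℤ, (R : ℝ)⁻¹ • (fun k => (f m k : ℝ)) ∈ Set.Icc (-1 : ι → ℝ) 1 ↔
        ∀ k, f m k ∈ Finset.Icc (-R : ℤ) R := by
      intro m
      rw [Set.mem_Icc, Pi.le_def, Pi.le_def, ← forall_and]
      refine forall_congr' fun k => ?_
      rw [Finset.mem_Icc, Pi.smul_apply, smul_eq_mul, inv_mul_eq_div, le_div_iff₀ hR',
        div_le_iff₀ hR']
      simp only [Pi.neg_apply, Pi.one_apply, neg_mul, one_mul]
      exact_mod_cast Iff.rfl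
    have hcone : ∀ w : ι → ℝ, (R : ℝ)⁻¹ • w ∈ S ↔ w ∈ S := by
      intro w
      refine ⟨fun h => ?_, hS _ (inv_pos.2 hR') w⟩
      have := hS _ hR' _ h
      rwa [smul_inv_smul₀ hR'.ne'] at this
    have : NeZero R := ⟨hR.ne'⟩
    ext x
    rw [Set.mem_inter_iff, ← Submodule.coe_pointwise_smul, SetLike.mem_coe,
      BoxIntegral.unitPartition.mem_smul_span_iff]
    constructor
    · rintro ⟨h1, h2⟩
      choose m hm using h2
      have hx : x = g m := by
        ext k
        have : (m k : ℝ) = R * x k := hm k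
        simp only [g]
        rw [this, inv_mul_cancel_left₀ hR'.ne']
      rw [hx, Set.mem_preimage, hsg, Set.mem_inter_iff, hcone, hbox] at h1
      exact ⟨m, h1, hx.symm⟩
    · rintro ⟨m, hm, rfl⟩
      refine ⟨?_, fun k => ⟨m k, ?_⟩⟩
      · rw [Set.mem_preimage, hsg, Set.mem_inter_iff, hcone, hbox]
        exact hm
      · simp only [g]
        rw [mul_inv_cancel_left₀ hR'.ne']
        rfl
  have h3 := Nat.card_image_of_injective hf M
  have h4 := Nat.card_image_of_injective hg M
  rw [← h1] at h3
  rw [h2, h4, ← h3]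
  rfl

/-- The lattice points of the sheared region number about `R ^ t` times its volume, where `t` is the
cardinality of `ι`, and the determinant supplies the factor `1 / γ`. Normalising by `(2 * R + 1) ^
t` leaves `2 ^ (-t)`, which is exactly the passage from `[-1, 1]^t` to `[0, 1]^t`. -/
theorem tendsto_pi_uniformInt {i j : ι} (hij : i ≠ j) {γ : ℕ} (hγ : 0 < γ) {S : Set (ι → ℝ)}
    (hmeas : MeasurableSet S) (hfront : volume (frontier S) = 0)
    (hS : ∀ t : ℝ, 0 < t → ∀ w ∈ S, t • w ∈ S)
    (hS' : ∀ c : ℝ, ∀ w ∈ S, (fun i => w i + c) ∈ S) :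
    Tendsto (fun R : ℕ => (Measure.pi fun _ : ι => uniformInt R)
      {n : ι → ℤ | (fun k => (n k : ℝ)) ∈ S ∧ (γ : ℤ) ∣ n j - n i}) atTop
      (𝓝 (volume (S ∩ Set.Icc 0 1) / γ)) := by
  have hγ' : (0 : ℝ) < γ := by exact_mod_cast hγ
  have hcont : Continuous (shear i j (γ : ℝ)) := LinearMap.continuous_of_finiteDimensional _
  have hdet : LinearMap.det (shear i j (γ : ℝ)) ≠ 0 := by rw [det_shear hij]; exact hγ'.ne'
  set s := shear i j (γ : ℝ) ⁻¹' (S ∩ Set.Icc (-1) 1) with hs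
  have hbdd : Bornology.IsBounded s := by
    -- All coordinates except `j` are unchanged by the shear; for that one, `|x i + γ * x j| ≤ 1`
    -- and `|x i| ≤ 1` give `γ * |x j| ≤ 2`.
    refine (Metric.isBounded_Icc (-2 : ι → ℝ) 2).subset fun x hx => ?_
    have hx' : ∀ k, -1 ≤ shear i j (γ : ℝ) x k ∧ shear i j (γ : ℝ) x k ≤ 1 :=
      fun k => ⟨hx.2.1 k, hx.2.2 k⟩
    have hne : ∀ k, k ≠ j → -1 ≤ x k ∧ x k ≤ 1 := by
      intro k hk
      have := hx' k
      rwa [shear_apply hij, if_neg hk] at this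
    have hall : ∀ k, -2 ≤ x k ∧ x k ≤ 2 := by
      intro k
      by_cases hk : k = j
      · subst hk
        have h1 := hx' k
        rw [shear_apply hij, if_pos rfl] at h1
        have h2 := hne i hij
        have h3 : (1 : ℝ) ≤ γ := by exact_mod_cast hγ
        constructor <;> nlinarith
      · have := hne k hk
        constructor <;> linarith
    exact ⟨fun k => (hall k).1, fun k => (hall k).2⟩
  have hsmeas : MeasurableSet s := hcont.measurable (hmeas.inter measurableSet_Icc)
  have hsfront : volume (frontier s) = 0 := by
    refine measure_mono_null (hcont.frontier_preimage_subset _) ?_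
    rw [Measure.addHaar_preimage_linearMap _ hdet, measure_mono_null (frontier_inter_subset _ _),
      mul_zero]
    refine measure_union_null (measure_mono_null Set.inter_subset_left hfront)
      (measure_mono_null Set.inter_subset_right ?_)
    exact (convex_Icc _ _).addHaar_frontier _
  have hvol : volume s = ENNReal.ofReal (γ : ℝ)⁻¹ * volume (S ∩ Set.Icc (-1) 1) := by
    rw [hs, Measure.addHaar_preimage_linearMap _ hdet, det_shear hij, abs_of_pos (inv_pos.2 hγ')]
  have hlim := tendsto_card_div_pow_atTop_volume s hbdd hsmeas hsfront
  have hratio : Tendsto (fun R : ℕ => ((R : ℝ) / (2 * R + 1 : ℕ)) ^ Fintype.card ι) atTop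
      (𝓝 ((2 ^ Fintype.card ι)⁻¹)) := by
    rw [← inv_pow]
    refine Tendsto.pow ?_ _
    have h1 : Tendsto (fun R : ℕ => (2 + (R : ℝ)⁻¹)⁻¹) atTop (𝓝 (2 + 0)⁻¹) :=
      ((tendsto_inv_atTop_nhds_zero_nat (𝕜 := ℝ)).const_add 2).inv₀ (by norm_num)
    rw [add_zero] at h1
    refine h1.congr' ?_
    filter_upwards [eventually_gt_atTop 0] with R hR
    have : (0 : ℝ) < R := by exact_mod_cast hR
    push_cast
    field_simp
  have hfinal := ENNReal.tendsto_ofReal (hlim.mul hratio)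
  have hval : ENNReal.ofReal (volume.real s * (2 ^ Fintype.card ι)⁻¹) =
      volume (S ∩ Set.Icc 0 1) / γ := by
    rw [ENNReal.ofReal_mul measureReal_nonneg, ofReal_measureReal hbdd.measure_lt_top.ne, hvol,
      volume_inter_Icc hS hS', ENNReal.div_eq_inv_mul, ENNReal.ofReal_inv_of_pos hγ',
      ENNReal.ofReal_natCast]
    ring
  rw [hval] at hfinal
  refine hfinal.congr' ?_
  filter_upwards [eventually_gt_atTop 0] with R hR
  have hR' : (0 : ℝ) < R := by exact_mod_cast hR
  rw [pi_uniformInt_apply, card_dvd_eq_card_shear hij hγ hS hR, div_mul_eq_mul_div, div_pow,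
    mul_div_assoc, div_right_comm, div_self (pow_ne_zero _ hR'.ne'), one_div,
    ENNReal.ofReal_mul (Nat.cast_nonneg _), ENNReal.ofReal_natCast,
    ENNReal.ofReal_inv_of_pos (by positivity), ENNReal.ofReal_pow (by positivity),
    ENNReal.ofReal_natCast, ENNReal.inv_pow]

end Equidistribution

/-! ### General position is open, conical and of full measure -/

section GeneralPosition

variable {A : Finset ℤ}

theorem turn_smul (a' a a'' : A) (t : ℝ) (w : A → ℝ) :
    turn a' a a'' (t • w) = t * turn a' a a'' w := by
  simp only [turn, Pi.smul_apply, smul_eq_mul]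
  ring

theorem turn_add_const (a' a a'' : A) (c : ℝ) (w : A → ℝ) :
    turn a' a a'' (fun i => w i + c) = turn a' a a'' w := by
  simp only [turn]
  ring

theorem continuous_turn (a' a a'' : A) : Continuous (turn a' a a'') := by
  unfold turn
  fun_prop

/-- Finitely many continuous functions, nonzero at `w`, keep their signs nearby. Hence the hull
support is locally constant on general position. -/
theorem eventually_turn_sign {w : A → ℝ} (hw : w ∈ generalPosition A) :
    ∀ᶠ w' in 𝓝 w, ∀ a' a a'' : A, a' < a → a < a'' →
      turn a' a a'' w' ≠ 0 ∧ (0 ≤ turn a' a a'' w' ↔ 0 ≤ turn a' a a'' w) := by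
  simp only [Filter.eventually_all]
  intro a' a a'' h1 h2
  have hc := (continuous_turn a' a a'').tendsto w
  rcases lt_or_gt_of_ne (hw a' a a'' h1 h2) with h | h
  · filter_upwards [hc.eventually (gt_mem_nhds h)] with w' hw'
    exact ⟨hw'.ne, iff_of_false (not_le.2 hw') (not_le.2 h)⟩
  · filter_upwards [hc.eventually (lt_mem_nhds h)] with w' hw'
    exact ⟨hw'.ne', iff_of_true hw'.le h.le⟩

theorem eventually_mem_newtonSupportSet_iff (B : Finset ℤ) {w : A → ℝ}
    (hw : w ∈ generalPosition A) :
    ∀ᶠ w' in 𝓝 w, w' ∈ newtonSupportSet A B ↔ w ∈ newtonSupportSet A B := by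
  filter_upwards [eventually_turn_sign hw] with w' hw'
  rw [mem_newtonSupportSet_iff, mem_newtonSupportSet_iff]
  refine forall_congr' fun a => iff_congr ?_ Iff.rfl
  exact forall₄_congr fun a' a'' h1 h2 => (hw' a' a a'' h1 h2).2

theorem isOpen_generalPosition : IsOpen (generalPosition A) := by
  rw [isOpen_iff_eventually]
  intro w hw
  filter_upwards [eventually_turn_sign hw] with w' hw' a' a a'' h1 h2
  exact (hw' a' a a'' h1 h2).1

theorem isOpen_inter_generalPosition {S : Set (A → ℝ)}
    (hS : ∀ w ∈ generalPosition A, ∀ᶠ w' in 𝓝 w, w' ∈ S ↔ w ∈ S) :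
    IsOpen (S ∩ generalPosition A) := by
  rw [isOpen_iff_eventually]
  intro w hw
  filter_upwards [hS w hw.2, isOpen_generalPosition.mem_nhds hw.2] with w' h1 h2
  exact ⟨h1.2 hw.1, h2⟩

/-- The complement lies in finitely many hyperplanes, each proper because its equation has a nonzero
coefficient at the middle index `a`. -/
theorem volume_compl_generalPosition : volume (generalPosition A)ᶜ = 0 := by
  have hsub : (generalPosition A)ᶜ ⊆ ⋃ (a' : A) (a : A) (a'' : A) (_ : a' < a) (_ : a < a''),
      {w : A → ℝ | turn a' a a'' w = 0} := by
    intro w hw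
    simp only [generalPosition, Set.mem_compl_iff, Set.mem_ofPred_eq, not_forall, not_not] at hw
    obtain ⟨a', a, a'', h1, h2, h3⟩ := hw
    simp only [Set.mem_iUnion]
    exact ⟨a', a, a'', h1, h2, h3⟩
  refine measure_mono_null hsub ?_
  simp only [measure_iUnion_null_iff]
  intro a' a a'' h1 h2
  let φ : (A → ℝ) →ₗ[ℝ] ℝ :=
    (((a'' : ℤ) : ℝ) - ((a : ℤ) : ℝ)) • LinearMap.proj a' +
      (((a : ℤ) : ℝ) - ((a' : ℤ) : ℝ)) • LinearMap.proj a'' -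
      (((a'' : ℤ) : ℝ) - ((a' : ℤ) : ℝ)) • LinearMap.proj a
  have hφ : ∀ w, φ w = turn a' a a'' w := by
    intro w
    simp only [φ, turn, LinearMap.sub_apply, LinearMap.add_apply, LinearMap.smul_apply,
      LinearMap.proj_apply, smul_eq_mul]
    ring
  have hset : {w : A → ℝ | turn a' a a'' w = 0} = (LinearMap.ker φ : Set (A → ℝ)) := by
    ext w
    simp [hφ]
  rw [hset]
  refine Measure.addHaar_submodule _ _ fun htop => ?_
  have h3 : φ (Pi.single a 1) = 0 := LinearMap.congr_fun (LinearMap.ker_eq_top.1 htop) _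
  rw [hφ, turn, Pi.single_eq_of_ne h1.ne, Pi.single_eq_of_ne h2.ne', Pi.single_eq_same] at h3
  have h4 := cast_lt_cast (h1.trans h2)
  linarith

/-- Local constancy makes the intersection open and relatively closed in general position, so its
frontier lies in the null complement. -/
theorem volume_frontier_inter_generalPosition {S : Set (A → ℝ)}
    (hS : ∀ w ∈ generalPosition A, ∀ᶠ w' in 𝓝 w, w' ∈ S ↔ w ∈ S) :
    volume (frontier (S ∩ generalPosition A)) = 0 := by
  refine measure_mono_null (t := (generalPosition A)ᶜ) (fun w hw hgen => ?_)
    volume_compl_generalPosition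
  rw [(isOpen_inter_generalPosition hS).frontier_eq] at hw
  have hwS : w ∉ S := fun h => hw.2 ⟨h, hgen⟩
  obtain ⟨w', h1, h2⟩ := ((mem_closure_iff_frequently.1 hw.1).and_eventually (hS w hgen)).exists
  exact hwS (h2.1 h1.1)

theorem generalPosition_smul_mem {t : ℝ} (ht : 0 < t) {w : A → ℝ} (hw : w ∈ generalPosition A) :
    t • w ∈ generalPosition A := by
  intro a' a a'' h1 h2
  rw [turn_smul]
  exact mul_ne_zero ht.ne' (hw a' a a'' h1 h2)

theorem generalPosition_add_const_mem (c : ℝ) {w : A → ℝ} (hw : w ∈ generalPosition A) :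
    (fun i => w i + c) ∈ generalPosition A := by
  intro a' a a'' h1 h2
  rw [turn_add_const]
  exact hw a' a a'' h1 h2

theorem newtonSupportSet_smul_mem {B : Finset ℤ} {t : ℝ} (ht : 0 < t) {w : A → ℝ}
    (hw : w ∈ newtonSupportSet A B) : t • w ∈ newtonSupportSet A B := by
  rw [mem_newtonSupportSet_iff] at hw ⊢
  simpa only [turn_smul, mul_nonneg_iff_of_pos_left ht] using hw

theorem newtonSupportSet_add_const_mem {B : Finset ℤ} (c : ℝ) {w : A → ℝ}
    (hw : w ∈ newtonSupportSet A B) : (fun i => w i + c) ∈ newtonSupportSet A B := by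
  rw [mem_newtonSupportSet_iff] at hw ⊢
  simpa only [turn_add_const] using hw

theorem volume_inter_generalPosition (S T : Set (A → ℝ)) :
    volume (S ∩ generalPosition A ∩ T) = volume (S ∩ T) := by
  rw [Set.inter_right_comm]
  exact measure_inter_conull volume_compl_generalPosition

theorem tendsto_newtonSupportProb {i j : A} (hij : i ≠ j) {γ : ℕ} (hγ : 0 < γ) (B : Finset ℤ) :
    Tendsto (fun R : ℕ => (Measure.pi fun _ : A => uniformInt R)
      {n : A → ℤ | (fun k => (n k : ℝ)) ∈ newtonSupportSet A B ∩ generalPosition A ∧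
        (γ : ℤ) ∣ n j - n i}) atTop (𝓝 (newtonSupportProb A B / γ)) := by
  have hS : ∀ w ∈ generalPosition A,
      ∀ᶠ w' in 𝓝 w, w' ∈ newtonSupportSet A B ↔ w ∈ newtonSupportSet A B :=
    fun w hw => eventually_mem_newtonSupportSet_iff B hw
  rw [newtonSupportProb, ← volume_inter_generalPosition]
  exact tendsto_pi_uniformInt hij hγ (isOpen_inter_generalPosition hS).measurableSet
    (volume_frontier_inter_generalPosition hS)
    (fun t ht w hw => ⟨newtonSupportSet_smul_mem ht hw.1, generalPosition_smul_mem ht hw.2⟩)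
    (fun c w hw => ⟨newtonSupportSet_add_const_mem c hw.1, generalPosition_add_const_mem c hw.2⟩)

/-- This is equidistribution with `γ = 1`, where divisibility is vacuous and the limit is the volume
of the whole unit cube. -/
theorem tendsto_prob_compl_generalPosition (hA : A.Nontrivial) :
    Tendsto (fun R : ℕ => (Measure.pi fun _ : A => uniformInt R)
      {n : A → ℤ | (fun k => (n k : ℝ)) ∈ generalPosition A}ᶜ) atTop (𝓝 0) := by
  obtain ⟨i, hi, j, hj, hij⟩ := hA
  have hne : (⟨i, hi⟩ : A) ≠ ⟨j, hj⟩ := fun h => hij (congrArg Subtype.val h)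
  have hlim := tendsto_pi_uniformInt hne one_pos
    (S := Set.univ ∩ generalPosition A)
    (isOpen_inter_generalPosition fun _ _ => by simp).measurableSet
    (volume_frontier_inter_generalPosition fun _ _ => by simp)
    (fun t ht w hw => ⟨trivial, generalPosition_smul_mem ht hw.2⟩)
    (fun c w hw => ⟨trivial, generalPosition_add_const_mem c hw.2⟩)
  have hone : volume (Set.univ ∩ generalPosition A ∩ Set.Icc 0 1) = 1 := by
    rw [volume_inter_generalPosition, Set.univ_inter, ← Set.pi_univ_Icc, volume_pi_pi]
    simp
  rw [hone] at hlim
  simp only [Nat.cast_one, div_one, one_dvd, and_true, Set.univ_inter] at hlim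
  have h2 := ENNReal.Tendsto.sub (tendsto_const_nhds (x := (1 : ℝ≥0∞))) hlim
    (.inl ENNReal.one_ne_top)
  rw [tsub_self] at h2
  refine h2.congr fun R => ?_
  exact (prob_compl_eq_one_sub MeasurableSet.of_discrete).symm

end GeneralPosition

/-! ### Degree bounds on numbers of roots -/

section RootBounds

variable {F : Type*} [Field F]

theorem encard_unit_roots_le {f : Polynomial F} (hf : f ≠ 0) {N : ℕ} (hN : f.natDegree ≤ N) :
    {x : Fˣ | f.eval (x : F) = 0}.encard ≤ N := by
  classical
  rw [← Units.val_injective.encard_image]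
  have hsub : ((fun x : Fˣ => (x : F)) '' {x : Fˣ | f.eval (x : F) = 0}) ⊆ f.roots.toFinset := by
    rintro _ ⟨x, hx, rfl⟩
    exact Multiset.mem_toFinset.2 ((Polynomial.mem_roots hf).2 hx)
  refine (Set.encard_le_encard hsub).trans ?_
  rw [Set.encard_coe_eq_coe_finsetCard]
  exact_mod_cast (Multiset.toFinset_card_le _).trans ((Polynomial.card_roots' f).trans hN)

/-- Division by `X ^ min A` gives a polynomial with nonzero constant term and degree at most `max A
- min A`. The bound is uniform in the coefficients, as needed to discard the exceptional exponents.
-/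
theorem encard_unitRoots_le {A : Finset ℤ} (hA : A.Nonempty) {c : A → F} (hc : ∀ a, c a ≠ 0) :
    (unitRoots A c).encard ≤ (A.max' hA - A.min' hA).toNat := by
  set l := A.min' hA
  have hl : ∀ a : A, l ≤ a := fun a => A.min'_le a a.2
  set f : Polynomial F := ∑ a : A, Polynomial.C (c a) * Polynomial.X ^ ((a : ℤ) - l).toNat with hf
  have hcoeff : f.coeff 0 ≠ 0 := by
    rw [hf, Polynomial.finsetSum_coeff, Finset.sum_eq_single ⟨l, A.min'_mem hA⟩]
    · simpa using hc _
    · intro a _ ha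
      have h1 : (a : ℤ) ≠ l := fun h => ha (Subtype.ext h)
      have h2 := hl a
      rw [Polynomial.coeff_C_mul_X_pow, if_neg (by omega)]
    · simp
  have hdeg : f.natDegree ≤ (A.max' hA - l).toNat := by
    refine Polynomial.natDegree_sum_le_of_forall_le _ _ fun a _ => ?_
    refine (Polynomial.natDegree_C_mul_X_pow_le _ _).trans ?_
    have := A.le_max' a a.2
    omega
  refine le_trans (Set.encard_le_encard fun x hx => ?_)
    (encard_unit_roots_le (fun h => hcoeff (by rw [h, Polynomial.coeff_zero])) hdeg)
  have hx' : ∑ a : A, c a * ((x ^ (a : ℤ) : Fˣ) : F) = 0 := hx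
  have : f.eval (x : F) = ((x ^ (-l) : Fˣ) : F) * ∑ a : A, c a * ((x ^ (a : ℤ) : Fˣ) : F) := by
    rw [hf, Polynomial.eval_finsetSum, Finset.mul_sum]
    refine Finset.sum_congr rfl fun a _ => ?_
    have h1 : ((a : ℤ) - l) = (((a : ℤ) - l).toNat : ℤ) := by have := hl a; omega
    have h2 : x ^ ((a : ℤ) - l).toNat = x ^ (-l) * x ^ (a : ℤ) := by
      rw [← zpow_add, ← zpow_natCast, ← h1]
      congr 1
      ring
    simp only [Polynomial.eval_mul, Polynomial.eval_C, Polynomial.eval_pow, Polynomial.eval_X]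
    rw [← Units.val_pow_eq_pow_val, h2, Units.val_mul]
    ring
  rw [Set.mem_ofPred_eq, this, hx', mul_zero]

theorem binomialRootCount_le {γ : ℕ} (hγ : 0 < γ) (p : Fˣ × Fˣ) :
    binomialRootCount F γ p ≤ γ := by
  have hdeg : (Polynomial.C (p.1 : F) * Polynomial.X ^ γ + Polynomial.C (p.2 : F)).natDegree = γ :=
    Polynomial.natDegree_add_C.trans (Polynomial.natDegree_C_mul_X_pow _ _ p.1.ne_zero)
  have hne : Polynomial.C (p.1 : F) * Polynomial.X ^ γ + Polynomial.C (p.2 : F) ≠ 0 := by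
    intro h
    rw [h, Polynomial.natDegree_zero] at hdeg
    exact hγ.ne hdeg
  have h := encard_unit_roots_le hne hdeg.le
  simp only [Polynomial.eval_add, Polynomial.eval_mul, Polynomial.eval_C, Polynomial.eval_pow,
    Polynomial.eval_X] at h
  exact (ENat.toENNReal_le.2 h).trans (by simp)

theorem expectedBinomialRoots_ne_top [MeasurableSpace Fˣ] {γ : ℕ} (hγ : 0 < γ) (D : Measure Fˣ)
    [IsProbabilityMeasure D] : expectedBinomialRoots F γ D ≠ ∞ := by
  refine ne_top_of_le_ne_top (ENNReal.natCast_ne_top γ) ?_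
  refine (lintegral_mono (binomialRootCount_le hγ)).trans ?_
  simp

end RootBounds

/-! ### Independence of exponents, digits and tails -/

section Independence

variable {ι X Y : Type*} [Fintype ι] [MeasurableSpace X] [MeasurableSpace Y]

theorem measurePreserving_eval_pair {τ : Measure X} [IsProbabilityMeasure τ] {i j : ι}
    (hij : i ≠ j) :
    MeasurePreserving (fun ω : ι → X => (ω i, ω j)) (Measure.pi fun _ => τ) (τ.prod τ) := by
  have hmi : Measurable fun ω : ι → X => ω i := measurable_pi_apply i
  have hmj : Measurable fun ω : ι → X => ω j := measurable_pi_apply j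
  refine ⟨hmi.prodMk hmj, ?_⟩
  have hind := (ProbabilityTheory.iIndepFun_pi (μ := fun _ : ι => τ) (X := fun _ x => x)
    fun _ => aemeasurable_id).indepFun hij
  rw [(ProbabilityTheory.indepFun_iff_map_prod_eq_prod_map_map hmi.aemeasurable
    hmj.aemeasurable).1 hind, (measurePreserving_eval (fun _ : ι => τ) i).map_eq,
    (measurePreserving_eval (fun _ : ι => τ) j).map_eq]

variable {ν : Measure ℤ} {ρ : Measure X} {σ : Measure Y} [IsProbabilityMeasure ν]
  [IsProbabilityMeasure ρ] [IsProbabilityMeasure σ]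

theorem measurePreserving_fst_pi :
    MeasurePreserving (fun ω : ι → ℤ × X × Y => fun k => (ω k).1)
      (Measure.pi fun _ => ν.prod (ρ.prod σ)) (Measure.pi fun _ => ν) :=
  measurePreserving_fst.comp
    (measurePreserving_arrowProdEquivProdArrow ℤ (X × Y) ι (fun _ => ν) fun _ => ρ.prod σ)

theorem measurePreserving_fst_pi_pair {i j : ι} (hij : i ≠ j) :
    MeasurePreserving (fun ω : ι → ℤ × X × Y => ((fun k => (ω k).1), ((ω i).2.1, (ω j).2.1)))
      (Measure.pi fun _ => ν.prod (ρ.prod σ)) ((Measure.pi fun _ => ν).prod (ρ.prod ρ)) := by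
  have h1 : MeasurePreserving (Prod.fst : X × Y → X) (ρ.prod σ) ρ := measurePreserving_fst
  have h2 := (h1.prod h1).comp (measurePreserving_eval_pair (τ := ρ.prod σ) hij)
  exact ((MeasurePreserving.id (Measure.pi fun _ : ι => ν)).prod h2).comp
    (measurePreserving_arrowProdEquivProdArrow ℤ (X × Y) ι (fun _ => ν) fun _ => ρ.prod σ)

/-- The exponent vector and two first digits have a product law, so the integral factors and the
tails drop out. -/
theorem lintegral_indicator_mul_pair {i j : ι} (hij : i ≠ j) (T : Set (ι → ℤ))
    {h : X × X → ℝ≥0∞} (hh : AEMeasurable h (ρ.prod ρ)) :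
    AEMeasurable (fun ω : ι → ℤ × X × Y =>
      T.indicator 1 (fun k => (ω k).1) * h ((ω i).2.1, (ω j).2.1))
      (Measure.pi fun _ => ν.prod (ρ.prod σ)) ∧
    ∫⁻ ω : ι → ℤ × X × Y, T.indicator 1 (fun k => (ω k).1) * h ((ω i).2.1, (ω j).2.1)
      ∂(Measure.pi fun _ => ν.prod (ρ.prod σ)) =
      (Measure.pi fun _ => ν) T * ∫⁻ p, h p ∂(ρ.prod ρ) := by
  have hT : Measurable (T.indicator (1 : (ι → ℤ) → ℝ≥0∞)) := Measurable.of_discrete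
  have hΦ := measurePreserving_fst_pi_pair (ν := ν) (ρ := ρ) (σ := σ) hij
  have hg : AEMeasurable (fun z : (ι → ℤ) × X × X => T.indicator 1 z.1 * h z.2)
      ((Measure.pi fun _ => ν).prod (ρ.prod ρ)) :=
    (hT.comp measurable_fst).aemeasurable.mul hh.comp_snd
  rw [← hΦ.map_eq] at hg
  refine ⟨hg.comp_measurable hΦ.measurable, ?_⟩
  have h1 := lintegral_map' hg hΦ.aemeasurable
  rw [hΦ.map_eq, lintegral_prod_mul hT.aemeasurable hh,
    lintegral_indicator_one MeasurableSet.of_discrete] at h1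
  exact h1.symm

end Independence

/-! ### Expectation and its limit -/

section ExpectedRoots

variable {K : Type*} [Field K] {v : AddValuation K (WithTop ℝ)} {π : K}

theorem exists_unit_eq_oneAddMax (e : OneAddMax v) :
    ∃ u : (valRing v)ˣ, ((u : valRing v) : K) = e ∧
      IsLocalRing.residue (valRing v) (u : valRing v) = 1 := by
  have hmem : (e : K) ∈ valRing v := by
    have h : (e : K) = ((e : K) - 1) + 1 := by ring
    rw [mem_valRing, h]
    refine le_trans (le_min e.2.le ?_) (v.map_add _ _)
    rw [v.map_one]
  have hres : IsLocalRing.residue (valRing v) ⟨e, hmem⟩ = 1 := by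
    rw [← map_one (IsLocalRing.residue (valRing v)), residue_eq_iff_pos]
    exact e.2
  obtain ⟨u, hu⟩ := (IsLocalRing.residue_ne_zero_iff_isUnit (⟨e, hmem⟩ : valRing v)).1
    (by rw [hres]; exact one_ne_zero)
  exact ⟨u, congrArg Subtype.val hu, by rw [hu, hres]⟩

/-- Tails have residue `1`, so a coefficient has the residue data of its digit alone; this is why
`D₂` does not enter the limit. -/
theorem exists_unit_assemble_eq {Δ : (ResField v)ˣ → (valRing v)ˣ} (hΔ : IsDigitSection v Δ)
    (c : ℤ × (ResField v)ˣ × OneAddMax v) :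
    ∃ W : (valRing v)ˣ, assemble v π Δ c = π ^ c.1 * ((W : valRing v) : K) ∧
      IsLocalRing.residue (valRing v) (W : valRing v) = c.2.1 := by
  obtain ⟨u, hu, hu1⟩ := exists_unit_eq_oneAddMax c.2.2
  refine ⟨Δ c.2.1 * u, ?_, ?_⟩
  · rw [assemble, ← hu, mul_assoc]
    rfl
  · rw [Units.val_mul, map_mul, hΔ, hu1, mul_one]

theorem residue_intCast_ne_zero {A : Finset ℤ}
    (hchar : ringChar (ResField v) = 0 ∨
      ∀ α ∈ A, ∀ β ∈ A, α ≠ β → IsCoprime (ringChar (ResField v) : ℤ) (α - β))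
    (a b : A) (hab : a < b) : (((b : ℤ) - a : ℤ) : ResField v) ≠ 0 := by
  have hne : (b : ℤ) ≠ a := fun h => hab.ne' (Subtype.ext h)
  rw [ne_eq, CharP.intCast_eq_zero_iff (ResField v) (ringChar (ResField v))]
  intro hdvd
  rcases hchar with h | h
  · rw [h, Nat.cast_zero, zero_dvd_iff, sub_eq_zero] at hdvd
    exact hne hdvd
  · have h1 := (h b b.2 a a.2 hne).isUnit_of_dvd' dvd_rfl hdvd
    rw [Int.isUnit_iff_natAbs_eq, Int.natAbs_natCast] at h1
    exact CharP.ringChar_ne_one h1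

/-- `|n * r| ≤ M` means `|n| ≤ ⌊M / r⌋`, which reduces the limit in `M` to one over natural numbers.
-/
theorem coeffLaw_eq (hπ : IsUniformizer v π) [MeasurableSpace (ResField v)ˣ]
    [MeasurableSpace (OneAddMax v)] (D₁ : Measure (ResField v)ˣ) (D₂ : Measure (OneAddMax v)) :
    ∃ r : ℝ, 0 < r ∧ ∀ M : ℝ, 0 ≤ M →
      coeffLaw v π D₁ D₂ M = (uniformInt ⌊M / r⌋₊).prod (D₁.prod D₂) := by
  obtain ⟨r, hr, hrn⟩ := hπ.exists_real
  refine ⟨r, hr, fun M hM => ?_⟩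
  have hset : {n : ℤ | ((-M : ℝ) : WithTop ℝ) ≤ v (π ^ n) ∧ v (π ^ n) ≤ (M : WithTop ℝ)} =
      ((Finset.Icc (-⌊M / r⌋₊ : ℤ) ⌊M / r⌋₊ : Finset ℤ) : Set ℤ) := by
    ext n
    have h1 : ((⌊M / r⌋₊ : ℕ) : ℤ) = ⌊M / r⌋ := Int.natCast_floor_eq_floor (by positivity)
    rw [Finset.mem_coe, Finset.mem_Icc, h1, Set.mem_ofPred_eq, hrn, WithTop.coe_le_coe,
      WithTop.coe_le_coe, neg_le (a := ⌊M / r⌋), Int.le_floor, Int.le_floor, le_div_iff₀ hr,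
      le_div_iff₀ hr, Int.cast_neg, neg_mul, neg_le]
  rw [coeffLaw, hset, uniformInt]

theorem sum_supportPairs {A B : Finset ℤ} (hBA : B ⊆ A) (f : ℤ × ℤ → ℝ≥0∞) :
    ∑ q ∈ supportPairs A B, f (q.1, q.2) = ∑ p ∈ consecutivePairs B, f p := by
  refine Finset.sum_bij (fun q _ => ((q.1 : ℤ), (q.2 : ℤ))) (fun q hq => mem_supportPairs.1 hq)
    ?_ ?_ fun _ _ => rfl
  · intro q _ q' _ h
    exact Prod.ext (Subtype.ext (congrArg Prod.fst h)) (Subtype.ext (congrArg Prod.snd h))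
  · intro p hp
    obtain ⟨h1, h2, -⟩ := mem_consecutivePairs_iff.1 hp
    exact ⟨(⟨p.1, hBA h1⟩, ⟨p.2, hBA h2⟩), mem_supportPairs.2 hp, rfl⟩

/-- The possible supports `B` of a lower hull. -/
def hullSupports (A : Finset ℤ) (hA : A.Nonempty) : Finset (Finset ℤ) :=
  {B ∈ A.powerset | A.min' hA ∈ B ∧ A.max' hA ∈ B}

/-- The chord inequalities determine `B`, and they are vacuous at the two extreme exponents. So the
sets `S(B/A)` partition the space. -/
theorem existsUnique_hullSupport {A : Finset ℤ} (hA : A.Nonempty) (w : A → ℝ) :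
    ∃ B ∈ hullSupports A hA, w ∈ newtonSupportSet A B ∧
      ∀ B' ∈ hullSupports A hA, w ∈ newtonSupportSet A B' → B' = B := by
  classical
  let V : Finset A := {a | ∀ a' a'' : A, a' < a → a < a'' → 0 ≤ turn a' a a'' w}
  have hV : ∀ a : A, (a : ℤ) ∈ V.map (Function.Embedding.subtype _) ↔
      ∀ a' a'' : A, a' < a → a < a'' → 0 ≤ turn a' a a'' w := by
    intro a
    simp [V]
  have hVA : V.map (Function.Embedding.subtype _) ⊆ A := by
    intro x hx
    obtain ⟨a, -, rfl⟩ := Finset.mem_map.1 hx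
    exact a.2
  refine ⟨V.map (Function.Embedding.subtype _), ?_, ?_, ?_⟩
  · refine Finset.mem_filter.2 ⟨Finset.mem_powerset.2 hVA, ?_, ?_⟩
    · exact (hV ⟨_, A.min'_mem hA⟩).2 fun a' _ h _ => absurd (A.min'_le a' a'.2) (not_le.2 h)
    · exact (hV ⟨_, A.max'_mem hA⟩).2 fun _ a'' _ h => absurd (A.le_max' a'' a''.2) (not_le.2 h)
  · exact mem_newtonSupportSet_iff.2 fun a => (hV a).symm
  · intro B' hB' hw
    have hB'A := Finset.mem_powerset.1 (Finset.mem_filter.1 hB').1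
    rw [mem_newtonSupportSet_iff] at hw
    ext x
    constructor
    · exact fun hx => (hV ⟨x, hB'A hx⟩).2 ((hw ⟨x, hB'A hx⟩).2 hx)
    · exact fun hx => (hw ⟨x, hVA hx⟩).1 ((hV ⟨x, hVA hx⟩).1 hx)

/-- The exponents whose Newton polygon is in general position with support `B` and whose slope
between `q.1` and `q.2` is integral. -/
def integralSlopeSet (A B : Finset ℤ) (q : A × A) : Set (A → ℤ) :=
  {n | (fun k => (n k : ℝ)) ∈ newtonSupportSet A B ∩ generalPosition A ∧
    ((((q.2 : ℤ) - q.1).toNat : ℕ) : ℤ) ∣ n q.2 - n q.1}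

theorem pairs_lt {A B : Finset ℤ} {q : A × A} (hq : q ∈ supportPairs A B) : q.1 < q.2 :=
  (mem_consecutivePairs_iff.1 (mem_supportPairs.1 hq)).2.2.1

/-- Summing over all `B`, of which only the actual hull support contributes, separates exponents
from digits in every term. -/
theorem encard_unitRoots_assemble (hcomplete : IsValComplete v) (hπ : IsUniformizer v π)
    {Δ : (ResField v)ˣ → (valRing v)ˣ} (hΔ : IsDigitSection v Δ) {A : Finset ℤ}
    (hA : A.Nonempty) (hchar : ∀ a b : A, a < b → (((b : ℤ) - a : ℤ) : ResField v) ≠ 0)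
    (ω : A → ℤ × (ResField v)ˣ × OneAddMax v)
    (hgen : (fun k => ((ω k).1 : ℝ)) ∈ generalPosition A) :
    (((unitRoots A fun a => assemble v π Δ (ω a)).encard : ℕ∞) : ℝ≥0∞) =
      ∑ B ∈ hullSupports A hA, ∑ q ∈ supportPairs A B,
        (integralSlopeSet A B q).indicator 1 (fun k => (ω k).1) *
          binomialRootCount (ResField v) ((q.2 : ℤ) - q.1).toNat
            ((ω q.2).2.1, (ω q.1).2.1) := by
  choose W hW hWres using fun a => exists_unit_assemble_eq (π := π) hΔ (ω a)
  obtain ⟨B, hB, hwB, huniq⟩ := existsUnique_hullSupport hA fun k => ((ω k).1 : ℝ)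
  rw [Finset.sum_eq_single B]
  · simp only [hW]
    rw [encard_unitRoots_of_generalPosition hcomplete hπ hA
      (Finset.mem_powerset.1 (Finset.mem_filter.1 hB).1) hchar hwB hgen (fun a => (ω a).2.1) hWres]
    refine (map_sum ENat.toENNRealRingHom _ _).trans ?_
    rw [Finset.sum_filter]
    refine Finset.sum_congr rfl fun q hq => ?_
    have hcast : ((((q.2 : ℤ) - q.1).toNat : ℕ) : ℤ) = (q.2 : ℤ) - q.1 :=
      Int.toNat_of_nonneg (sub_nonneg.2 (pairs_lt hq).le)
    by_cases hdvd : ((q.2 : ℤ) - q.1) ∣ (ω q.2).1 - (ω q.1).1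
    · have hmem : (fun k => (ω k).1) ∈ integralSlopeSet A B q :=
        ⟨⟨hwB, hgen⟩, by rw [hcast]; exact hdvd⟩
      rw [if_pos hdvd, Set.indicator_of_mem hmem, Pi.one_apply, one_mul]
      rfl
    · have hmem : (fun k => (ω k).1) ∉ integralSlopeSet A B q := by
        rintro ⟨-, h⟩
        rw [hcast] at h
        exact hdvd h
      rw [if_neg hdvd, Set.indicator_of_notMem hmem, zero_mul]
  · intro B' hB' hne
    refine Finset.sum_eq_zero fun q _ => ?_
    rw [Set.indicator_of_notMem, zero_mul]
    exact fun h => hne (huniq B' hB' h.1.1)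
  · exact fun h => absurd hB h

theorem tendsto_lintegral_encard_unitRoots (hcomplete : IsValComplete v)
    (hπ : IsUniformizer v π) {Δ : (ResField v)ˣ → (valRing v)ˣ} (hΔ : IsDigitSection v Δ)
    [MeasurableSpace (ResField v)ˣ] [MeasurableSpace (OneAddMax v)]
    (D₁ : Measure (ResField v)ˣ) [IsProbabilityMeasure D₁]
    (D₂ : Measure (OneAddMax v)) [IsProbabilityMeasure D₂] {A : Finset ℤ} (hA : A.Nontrivial)
    (hchar : ∀ a b : A, a < b → (((b : ℤ) - a : ℤ) : ResField v) ≠ 0)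
    (hmeas : ∀ α ∈ A, ∀ β ∈ A, α < β →
      AEMeasurable (binomialRootCount (ResField v) (β - α).toNat) (D₁.prod D₁)) :
    Tendsto (fun R : ℕ => ∫⁻ ω : A → ℤ × (ResField v)ˣ × OneAddMax v,
        (((unitRoots A fun a => assemble v π Δ (ω a)).encard : ℕ∞) : ℝ≥0∞)
        ∂(Measure.pi fun _ : A => (uniformInt R).prod (D₁.prod D₂))) atTop
      (𝓝 (∑ B ∈ hullSupports A hA.nonempty, ∑ q ∈ supportPairs A B,
        newtonSupportProb A B / (((q.2 : ℤ) - q.1).toNat : ℕ) *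
          expectedBinomialRoots (ResField v) ((q.2 : ℤ) - q.1).toNat D₁)) := by
  set N : ℕ := (A.max' hA.nonempty - A.min' hA.nonempty).toNat
  let f : (A → ℤ × (ResField v)ˣ × OneAddMax v) → ℝ≥0∞ := fun ω =>
    (((unitRoots A fun a => assemble v π Δ (ω a)).encard : ℕ∞) : ℝ≥0∞)
  let term : Finset ℤ → A × A → (A → ℤ × (ResField v)ˣ × OneAddMax v) → ℝ≥0∞ := fun B q ω =>
    (integralSlopeSet A B q).indicator 1 (fun k => (ω k).1) *
      binomialRootCount (ResField v) ((q.2 : ℤ) - q.1).toNat ((ω q.2).2.1, (ω q.1).2.1)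
  let G : Set (A → ℤ) := {n | (fun k => (n k : ℝ)) ∈ generalPosition A}
  let G' : Set (A → ℤ × (ResField v)ˣ × OneAddMax v) := (fun ω k => (ω k).1) ⁻¹' G
  have hfst : Measurable
      (fun (ω : A → ℤ × (ResField v)ˣ × OneAddMax v) k => (ω k).1) := by fun_prop
  have hG' : MeasurableSet G' := hfst MeasurableSet.of_discrete
  have hpos : ∀ B : Finset ℤ, ∀ q ∈ supportPairs A B, 0 < ((q.2 : ℤ) - q.1).toNat := by
    intro B q hq
    have : (q.1 : ℤ) < q.2 := pairs_lt hq
    omega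
  have hbound : ∀ ω, f ω ≤ N := by
    intro ω
    choose W hW hWres using fun a => exists_unit_assemble_eq (π := π) hΔ (ω a)
    have := encard_unitRoots_le (c := fun a => assemble v π Δ (ω a)) hA.nonempty fun a => by
      rw [hW]
      exact mul_ne_zero (zpow_ne_zero _ hπ.1) fun h => (W a).ne_zero (Subtype.ext h)
    exact (ENat.toENNReal_le.2 this).trans (by simp [N])
  have hterm : ∀ R : ℕ, ∀ B : Finset ℤ, ∀ q ∈ supportPairs A B,
      AEMeasurable (term B q) (Measure.pi fun _ => (uniformInt R).prod (D₁.prod D₂)) ∧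
      ∫⁻ ω, term B q ω ∂(Measure.pi fun _ => (uniformInt R).prod (D₁.prod D₂)) =
        (Measure.pi fun _ => uniformInt R) (integralSlopeSet A B q) *
          expectedBinomialRoots (ResField v) ((q.2 : ℤ) - q.1).toNat D₁ :=
    fun R B q hq => lintegral_indicator_mul_pair (pairs_lt hq).ne' _
      (hmeas q.1 q.1.2 q.2 q.2.2 (pairs_lt hq))
  -- On general position the root count agrees pointwise with a finite sum of products, each
  -- integrated by independence.
  have hmain : ∀ R : ℕ,
      ∫⁻ ω in G', f ω ∂(Measure.pi fun _ => (uniformInt R).prod (D₁.prod D₂)) =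
      ∑ B ∈ hullSupports A hA.nonempty, ∑ q ∈ supportPairs A B,
        (Measure.pi fun _ => uniformInt R) (integralSlopeSet A B q) *
          expectedBinomialRoots (ResField v) ((q.2 : ℤ) - q.1).toNat D₁ := by
    intro R
    rw [← lintegral_indicator hG']
    have hpt : ∀ ω, G'.indicator f ω =
        ∑ B ∈ hullSupports A hA.nonempty, ∑ q ∈ supportPairs A B, term B q ω := by
      intro ω
      by_cases hω : ω ∈ G'
      · rw [Set.indicator_of_mem hω]
        exact encard_unitRoots_assemble hcomplete hπ hΔ hA.nonempty hchar ω hω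
      · rw [Set.indicator_of_notMem hω]
        refine (Finset.sum_eq_zero fun B _ => Finset.sum_eq_zero fun q _ => ?_).symm
        simp only [term]
        rw [Set.indicator_of_notMem, zero_mul]
        exact fun h => hω h.1.2
    simp only [hpt]
    rw [lintegral_finsetSum' _ fun B _ => Finset.aemeasurable_fun_sum _ fun q hq =>
      (hterm R B q hq).1]
    refine Finset.sum_congr rfl fun B _ => ?_
    rw [lintegral_finsetSum' _ fun q hq => (hterm R B q hq).1]
    exact Finset.sum_congr rfl fun q hq => (hterm R B q hq).2
  -- Off general position the count is at most `N`, on an event whose probability tends to `0`.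
  have herr : Tendsto (fun R : ℕ =>
      ∫⁻ ω in G'ᶜ, f ω ∂(Measure.pi fun _ => (uniformInt R).prod (D₁.prod D₂))) atTop (𝓝 0) := by
    have hlim := ENNReal.Tendsto.const_mul (a := (N : ℝ≥0∞))
      (tendsto_prob_compl_generalPosition hA) (.inr (ENNReal.natCast_ne_top N))
    rw [mul_zero] at hlim
    refine tendsto_of_tendsto_of_tendsto_of_le_of_le tendsto_const_nhds hlim
      (fun _ => zero_le) fun R => ?_
    refine (lintegral_mono hbound).trans ?_
    rw [setLIntegral_const, ← (measurePreserving_fst_pi (ι := A) (ν := uniformInt R) (ρ := D₁)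
      (σ := D₂)).measure_preimage MeasurableSet.of_discrete.nullMeasurableSet]
    exact le_rfl
  have hsum := (tendsto_finsetSum (hullSupports A hA.nonempty) fun B _ =>
    tendsto_finsetSum (supportPairs A B) fun q hq =>
      ENNReal.Tendsto.mul_const
        (b := expectedBinomialRoots (ResField v) ((q.2 : ℤ) - q.1).toNat D₁)
        (tendsto_newtonSupportProb (pairs_lt hq).ne (hpos B q hq) B)
        (.inr (expectedBinomialRoots_ne_top (hpos B q hq) D₁))).add herr
  rw [add_zero] at hsum
  refine hsum.congr fun R => ?_
  -- Splitting along `G'` needs measurability of `G'` only, not of the root count.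
  exact (congrArg (· + _) (hmain R).symm).trans (lintegral_add_compl f hG')

end ExpectedRoots

end SparseRoots

theorem mainTheorem5 {K : Type*} [Field K] (v : AddValuation K (WithTop ℝ))
    (hcomplete : IsValComplete v)
    (π : K) (hπ : IsUniformizer v π)
    (Δ : (ResField v)ˣ → (valRing v)ˣ) (hΔ : IsDigitSection v Δ)
    [MeasurableSpace (ResField v)ˣ] [MeasurableSpace (OneAddMax v)]
    (D₁ : Measure (ResField v)ˣ) [IsProbabilityMeasure D₁]
    (D₂ : Measure (OneAddMax v)) [IsProbabilityMeasure D₂]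
    (A : Finset ℤ) (hA : A.Nontrivial)
    (hchar : ringChar (ResField v) = 0 ∨
      ∀ α ∈ A, ∀ β ∈ A, α ≠ β → IsCoprime (ringChar (ResField v) : ℤ) (α - β))
    (hmeas : ∀ α ∈ A, ∀ β ∈ A, α < β →
      AEMeasurable (binomialRootCount (ResField v) (β - α).toNat) (D₁.prod D₁)) :
    Tendsto (fun M : ℝ => expectedRoots v π Δ D₁ D₂ A M) atTop
      (𝓝 (∑ B ∈ A.powerset with A.min' hA.nonempty ∈ B ∧ A.max' hA.nonempty ∈ B,
        newtonSupportProb A B *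
          ∑ p ∈ consecutivePairs B,
            expectedBinomialRoots (ResField v) (p.2 - p.1).toNat D₁ /
              (((p.2 - p.1).toNat : ℕ) : ℝ≥0∞))) := by
  obtain ⟨r, hr, hlaw⟩ := coeffLaw_eq hπ D₁ D₂
  have hfloor : Tendsto (fun M : ℝ => ⌊M / r⌋₊) atTop atTop :=
    tendsto_nat_floor_atTop.comp (tendsto_id.atTop_div_const hr)
  have hlim := (tendsto_lintegral_encard_unitRoots hcomplete hπ hΔ D₁ D₂ hA
    (residue_intCast_ne_zero hchar) hmeas).comp hfloor
  have hval : ∑ B ∈ hullSupports A hA.nonempty, ∑ q ∈ supportPairs A B,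
        newtonSupportProb A B / (((q.2 : ℤ) - q.1).toNat : ℕ) *
          expectedBinomialRoots (ResField v) ((q.2 : ℤ) - q.1).toNat D₁ =
      ∑ B ∈ A.powerset with A.min' hA.nonempty ∈ B ∧ A.max' hA.nonempty ∈ B,
        newtonSupportProb A B *
          ∑ p ∈ consecutivePairs B,
            expectedBinomialRoots (ResField v) (p.2 - p.1).toNat D₁ /
              (((p.2 - p.1).toNat : ℕ) : ℝ≥0∞) := by
    refine Finset.sum_congr rfl fun B hB => ?_
    have hBA := Finset.mem_powerset.1 (Finset.mem_filter.1 hB).1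
    rw [← sum_supportPairs hBA, Finset.mul_sum]
    refine Finset.sum_congr rfl fun q _ => ?_
    rw [div_eq_mul_inv, div_eq_mul_inv]
    ring
  rw [hval] at hlim
  refine hlim.congr' ?_
  filter_upwards [eventually_ge_atTop 0] with M hM
  rw [expectedRoots, hlaw M hM]
  rfl
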